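/- Theorem 1. Let $d\ge 1$ and let $Y(t)$, $t\in\mathbb R^d$, be a centered Gaussian random field with (almost surely) continuous sample paths which is homogeneous, i.e. for every $h\in\mathbb R^d$ the fields $Y(\cdot+h)$ and $Y(\cdot)$ have the same finite-dimensional distributions. Assume that its covariance function $B_Y(t)=\mathbb E\,Y(t)Y(0)$ satisfies $B_Y(t)\ge 0$ for all $t\in\mathbb R^d$ and $B_Y(0)=1$. Let $G\subset\mathbb R^d$ be a bounded region (a connected set with nonempty interior) with regular boundary: if $\mathbb R^d$ is divided into the closed cubes $\delta(n+[0,1]^d)$, $n\in\mathbb Z^d$, then both the total volume of the cubes contained in $G$ and the total volume of the cubes that meet $G$ converge to the volume $|G|$ as $\delta\downarrow 0$. Then the persistence exponent $$\theta_Y(G)=\lim_{T\to\infty}\frac{-\ln P\bigl(Y(t)\le 0 \text{ for all } t\in TG\bigr)}{T^d},\qquad TG=\{Tt: t\in G\},$$ where $\ln 0=-\infty$, exists and is finite. If, in addition, $B_Y\in L_1(\mathbb R^d)$, then $\theta_Y(G)>0$. -/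

import Mathlib

open MeasureTheory ProbabilityTheory Filter Topology
open scoped Pointwise

noncomputable section

/-- The field `Y` on `ℝ^d` is homogeneous: for every shift `h`, the fields `t ↦ Y (t + h)` and `Y`
have the same law, i.e. the same finite-dimensional distributions. -/
def IsHomogeneousField {Ω : Type*} [MeasurableSpace Ω] {d : ℕ}
    (Y : (Fin d → ℝ) → Ω → ℝ) (P : Measure Ω) : Prop :=
  ∀ (h : Fin d → ℝ) (I : Finset (Fin d → ℝ)),
    P.map (fun ω (t : I) => Y (t.1 + h) ω) = P.map (fun ω (t : I) => Y t.1 ω)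

/-- The covariance function `B_Y(t) = Cov(Y(t), Y(0))` of a homogeneous field. -/
def fieldCov {Ω : Type*} [MeasurableSpace Ω] {d : ℕ}
    (Y : (Fin d → ℝ) → Ω → ℝ) (P : Measure Ω) (t : Fin d → ℝ) : ℝ :=
  covariance (Y t) (Y 0) P

/-- A region: a connected set having internal points. -/
structure IsRegion {d : ℕ} (G : Set (Fin d → ℝ)) : Prop where
  isConnected : IsConnected G
  nonempty_interior : (interior G).Nonempty

/-- The element (closed cube) with index `n` of the standard rectangular lattice of step `δ`. -/
def latticeCell {d : ℕ} (δ : ℝ) (n : Fin d → ℤ) : Set (Fin d → ℝ) :=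
  {x | ∀ i, δ * (n i : ℝ) ≤ x i ∧ x i ≤ δ * ((n i : ℝ) + 1)}

/-- Internal measure: the sum of the volumes of the lattice elements contained in `G`. -/
def internalLatticeMeasure {d : ℕ} (δ : ℝ) (G : Set (Fin d → ℝ)) : ENNReal :=
  ∑' n : {n : Fin d → ℤ // latticeCell δ n ⊆ G}, volume (latticeCell δ n.1)

/-- External measure: the sum of the volumes of the lattice elements that meet `G`. -/
def externalLatticeMeasure {d : ℕ} (δ : ℝ) (G : Set (Fin d → ℝ)) : ENNReal :=
  ∑' n : {n : Fin d → ℤ // (latticeCell δ n ∩ G).Nonempty}, volume (latticeCell δ n.1)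

/-- `G` has a regular boundary: its internal and external lattice measures both converge to the
volume `|G|` as the step `δ` decreases to `0`. -/
structure HasRegularBoundary {d : ℕ} (G : Set (Fin d → ℝ)) : Prop where
  internal : Tendsto (fun δ : ℝ => internalLatticeMeasure δ G) (𝓝[>] 0) (𝓝 (volume G))
  external : Tendsto (fun δ : ℝ => externalLatticeMeasure δ G) (𝓝[>] 0) (𝓝 (volume G))

/-- The persistence probability `P(Y ≤ 0 on G)`. -/
def persistenceProb {Ω : Type*} [MeasurableSpace Ω] {d : ℕ}
    (Y : (Fin d → ℝ) → Ω → ℝ) (P : Measure Ω) (G : Set (Fin d → ℝ)) : ENNReal :=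
  P {ω | ∀ t ∈ G, Y t ω ≤ 0}

/-- The persistence exponent of `Y` relative to `G` exists, with value `θ` in `[-∞, ∞]`:
`- ln P(Y ≤ 0 on TG) / T^d → θ` as `T → ∞`. The logarithm is the extended one, `ln 0 = -∞`. -/
def HasPersistenceExponent {Ω : Type*} [MeasurableSpace Ω] {d : ℕ}
    (Y : (Fin d → ℝ) → Ω → ℝ) (P : Measure Ω) (G : Set (Fin d → ℝ)) (θ : EReal) : Prop :=
  Tendsto (fun T : ℝ => -ENNReal.log (persistenceProb Y P (T • G)) / ((T ^ d : ℝ) : EReal))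
    atTop (𝓝 θ)

end

/-! The set function `f A = -log P(Y ≤ 0 on A)` is monotone and translation invariant, and it is
subadditive because nonnegatively correlated Gaussian variables are associated: P(Y ≤ 0 on A ∪ B) ≥
P(Y ≤ 0 on A) P(Y ≤ 0 on B). A Fekete argument gives `f([0,T]^d) / T^d → θ`, an infimum
(`exists_tendsto_stdCube`), and the regular boundary transfers this to `f(TG) / T^d → θ |G|`
(`tendsto_smul_div`). Finiteness comes from positivity on a small cube, spread to bounded sets by
association (`persistenceProb_pos`).

Association (`measure_orthant_mul_le`) is proved by rotating an independent copy X' of the vector X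
into X. With U = sin θ X + cos θ X', the derivative in θ of E 1_A(X) g(U), for g a smooth decreasing
approximation of an orthant indicator, involves dU/dθ, which is independent of U and nonnegatively
correlated with X; this fixes its sign.

Strict positivity uses `measure_orthant_le`. Adding to X an independent Gaussian noise whose
covariance is the graph Laplacian of the covariance matrix K makes the coordinates independent; the
price is exp(tr) of that Laplacian, that is, exp of the off-diagonal sum of K. If B_Y is integrable,
a number of points proportional to T^d can be placed in [0,T]^d with off-diagonal sum at most a
small multiple of their number (`exists_points_sum_le`), so the persistence probability decays
exponentially in T^d. -/

/-- A nonnegative set function which, on bounded sets, is monotone, subadditive and invariant under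
translations. -/
structure IsInvariantSubadditive {d : ℕ} (f : Set (Fin d → ℝ) → ℝ) : Prop where
  nonneg : ∀ A, 0 ≤ f A
  empty : f ∅ = 0
  mono : ∀ A B, A ⊆ B → Bornology.IsBounded B → f A ≤ f B
  union_le : ∀ A B, Bornology.IsBounded A → Bornology.IsBounded B → f (A ∪ B) ≤ f A + f B
  translate : ∀ A h, f ((fun x => x + h) '' A) = f A

/-- The cube `[0, T]^d`. -/
def stdCube (d : ℕ) (T : ℝ) : Set (Fin d → ℝ) := Set.Icc 0 fun _ => T

/-! ### Lattice cells: covering, scaling and counting. -/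

section Lattice

variable {d : ℕ}

theorem latticeCell_eq_Icc (δ : ℝ) (n : Fin d → ℤ) :
    latticeCell δ n = Set.Icc (fun i => δ * (n i : ℝ)) fun i => δ * ((n i : ℝ) + 1) := by
  ext x
  simp only [latticeCell, Set.mem_ofPred_eq, Set.mem_Icc, Pi.le_def]
  exact forall_and

theorem image_add_stdCube (T : ℝ) (a : Fin d → ℝ) :
    (fun x => x + a) '' stdCube d T = Set.Icc a fun i => T + a i := by
  unfold stdCube
  rw [Set.image_add_const_Icc, zero_add]
  rfl

theorem latticeCell_eq_image (δ : ℝ) (n : Fin d → ℤ) :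
    latticeCell δ n = (fun x => x + fun i => δ * (n i : ℝ)) '' stdCube d δ := by
  rw [image_add_stdCube, latticeCell_eq_Icc]
  congr 1
  ext i
  ring

theorem isBounded_latticeCell (δ : ℝ) (n : Fin d → ℤ) : Bornology.IsBounded (latticeCell δ n) := by
  rw [latticeCell_eq_Icc]; exact Metric.isBounded_Icc _ _

theorem latticeCell_nonempty {δ : ℝ} (hδ : 0 ≤ δ) (n : Fin d → ℤ) : (latticeCell δ n).Nonempty :=
  ⟨fun i => δ * (n i : ℝ), fun i => ⟨le_rfl, by nlinarith⟩⟩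

theorem volume_latticeCell (δ : ℝ) (n : Fin d → ℤ) :
    volume (latticeCell δ n) = ENNReal.ofReal δ ^ d := by
  rw [latticeCell_eq_Icc, Real.volume_Icc_pi]
  have : ∀ i, δ * ((n i : ℝ) + 1) - δ * (n i : ℝ) = δ := fun i => by ring
  simp [this]

theorem smul_latticeCell {T : ℝ} (hT : 0 < T) (δ : ℝ) (n : Fin d → ℤ) :
    T • latticeCell δ n = latticeCell (T * δ) n := by
  ext x
  rw [Set.mem_smul_set_iff_inv_smul_mem₀ hT.ne']
  simp only [latticeCell, Set.mem_ofPred_eq, Pi.smul_apply, smul_eq_mul]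
  refine forall_congr' fun i => and_congr ?_ ?_
  · rw [inv_mul_eq_div, le_div_iff₀ hT]; ring_nf
  · rw [inv_mul_eq_div, div_le_iff₀ hT]; ring_nf

theorem exists_mem_latticeCell {δ : ℝ} (hδ : 0 < δ) {a b : ℤ} (hab : a < b) {x : Fin d → ℝ}
    (hx : ∀ i, a * δ ≤ x i ∧ x i ≤ b * δ) :
    ∃ n ∈ Fintype.piFinset fun _ : Fin d => Finset.Ico a b, x ∈ latticeCell δ n := by
  -- The minimum with `b - 1` handles points on the upper face `x i = b * δ`, whose floor is `b`.
  refine ⟨fun i => min ⌊x i / δ⌋ (b - 1), ?_, fun i => ?_⟩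
  · simp only [Fintype.mem_piFinset, Finset.mem_Ico, le_min_iff, min_lt_iff]
    refine fun i => ⟨⟨?_, by omega⟩, Or.inr (by omega)⟩
    rw [Int.le_floor, le_div_iff₀ hδ]
    exact (hx i).1
  · have h1 := Int.floor_le (x i / δ)
    have h2 := Int.lt_floor_add_one (x i / δ)
    rw [le_div_iff₀ hδ] at h1
    rw [div_lt_iff₀ hδ] at h2
    dsimp only
    rcases le_total ⌊x i / δ⌋ (b - 1) with h | h
    · rw [min_eq_left h]
      constructor <;> nlinarith
    · rw [min_eq_right h]
      have h' : ((b - 1 : ℤ) : ℝ) ≤ (⌊x i / δ⌋ : ℝ) := by exact_mod_cast h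
      push_cast at h' ⊢
      have := (hx i).2
      constructor <;> nlinarith

theorem card_piFinset_Ico {a b : ℤ} (hab : a ≤ b) :
    ((Fintype.piFinset fun _ : Fin d => Finset.Ico a b).card : ℝ) = ((b : ℝ) - a) ^ d := by
  rw [Fintype.card_piFinset]
  simp only [Int.card_Ico, Finset.prod_const, Finset.card_univ, Fintype.card_fin, Nat.cast_pow]
  congr 1
  have : ((b - a).toNat : ℤ) = b - a := Int.toNat_of_nonneg (by omega)
  exact_mod_cast this

theorem exists_index_bound {G : Set (Fin d → ℝ)} (hG : Bornology.IsBounded G) {δ : ℝ}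
    (hδ : 0 < δ) : ∃ M : ℕ, 0 < M ∧ ∀ n : Fin d → ℤ, (latticeCell δ n ∩ G).Nonempty →
      n ∈ Fintype.piFinset fun _ : Fin d => Finset.Ico (-(M : ℤ)) M := by
  obtain ⟨r, hr⟩ := hG.subset_closedBall 0
  refine ⟨⌈r / δ⌉₊ + 1, by omega, ?_⟩
  rintro n ⟨x, hx, hxG⟩
  rw [Fintype.mem_piFinset]
  intro i
  have h1 : |x i| ≤ r := by
    have h2 := hr hxG
    rw [mem_closedBall_zero_iff] at h2
    exact (norm_le_pi_norm x i).trans h2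
  have h2 := abs_le.1 h1
  have h3 : r ≤ ⌈r / δ⌉₊ * δ := by
    rw [← div_le_iff₀ hδ]; exact Nat.le_ceil _
  have h4 := hx i
  rw [Finset.mem_Ico]
  have h5 : -((⌈r / δ⌉₊ : ℝ) + 1) ≤ n i := by
    by_contra! h
    nlinarith
  have h6 : (n i : ℝ) < (⌈r / δ⌉₊ : ℝ) + 1 := by
    by_contra! h
    nlinarith
  constructor
  · exact_mod_cast h5
  · exact_mod_cast h6

theorem toReal_internalLatticeMeasure {δ : ℝ} (hδ : 0 ≤ δ) {G : Set (Fin d → ℝ)}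
    {s : Finset (Fin d → ℤ)} (hs : ∀ n, n ∈ s ↔ latticeCell δ n ⊆ G) :
    (internalLatticeMeasure δ G).toReal = s.card * δ ^ d := by
  unfold internalLatticeMeasure
  have : {n : Fin d → ℤ | latticeCell δ n ⊆ G} = (s : Set (Fin d → ℤ)) := by
    ext n; simp [hs]
  simp_rw [volume_latticeCell]
  rw [ENNReal.tsum_const, ENNReal.toReal_mul, ENNReal.toReal_pow, ENNReal.toReal_ofReal hδ]
  congr 1
  have e : ENat.card {n : Fin d → ℤ // latticeCell δ n ⊆ G} = s.card := by
    rw [← Set.encard_coe_eq_coe_finsetCard, ← this]; rfl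
  rw [e]; simp

theorem toReal_externalLatticeMeasure {δ : ℝ} (hδ : 0 ≤ δ) {G : Set (Fin d → ℝ)}
    {s : Finset (Fin d → ℤ)} (hs : ∀ n, n ∈ s ↔ (latticeCell δ n ∩ G).Nonempty) :
    (externalLatticeMeasure δ G).toReal = s.card * δ ^ d := by
  unfold externalLatticeMeasure
  have : {n : Fin d → ℤ | (latticeCell δ n ∩ G).Nonempty} = (s : Set (Fin d → ℤ)) := by
    ext n; simp [hs]
  simp_rw [volume_latticeCell]
  rw [ENNReal.tsum_const, ENNReal.toReal_mul, ENNReal.toReal_pow, ENNReal.toReal_ofReal hδ]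
  congr 1
  have e : ENat.card {n : Fin d → ℤ // (latticeCell δ n ∩ G).Nonempty} = s.card := by
    rw [← Set.encard_coe_eq_coe_finsetCard, ← this]; rfl
  rw [e]; simp

end Lattice

/-! ### Asymptotics of invariant subadditive set functions. -/

namespace IsInvariantSubadditive

variable {d : ℕ} {f : Set (Fin d → ℝ) → ℝ}

theorem latticeCell_eq (hf : IsInvariantSubadditive f) (δ : ℝ) (n : Fin d → ℤ) :
    f (latticeCell δ n) = f (stdCube d δ) := by
  rw [latticeCell_eq_image, hf.translate]

theorem biUnion_latticeCell_le (hf : IsInvariantSubadditive f) (δ : ℝ) (s : Finset (Fin d → ℤ)) :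
    Bornology.IsBounded (⋃ n ∈ s, latticeCell δ n) ∧
      f (⋃ n ∈ s, latticeCell δ n) ≤ s.card * f (stdCube d δ) := by
  classical
  induction s using Finset.induction_on with
  | empty => simp [hf.empty]
  | insert n s hn ih =>
    rw [Finset.set_biUnion_insert, Finset.card_insert_of_notMem hn]
    refine ⟨(isBounded_latticeCell δ n).union ih.1,
      (hf.union_le _ _ (isBounded_latticeCell δ n) ih.1).trans ?_⟩
    rw [hf.latticeCell_eq]
    push_cast
    linarith [ih.2]

theorem le_card_mul (hf : IsInvariantSubadditive f) {δ : ℝ} {s : Finset (Fin d → ℤ)}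
    {A : Set (Fin d → ℝ)} (hA : A ⊆ ⋃ n ∈ s, latticeCell δ n) :
    f A ≤ s.card * f (stdCube d δ) :=
  (hf.mono _ _ hA (hf.biUnion_latticeCell_le δ s).1).trans (hf.biUnion_latticeCell_le δ s).2

theorem stdCube_le (hf : IsInvariantSubadditive f) {T L : ℝ} (hT : 0 < T) (hL : 0 < L) :
    f (stdCube d T) ≤ (⌈T / L⌉₊ : ℝ) ^ d * f (stdCube d L) := by
  have hpos : (0 : ℤ) < (⌈T / L⌉₊ : ℤ) := by exact_mod_cast Nat.ceil_pos.2 (div_pos hT hL)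
  have := hf.le_card_mul (δ := L) (A := stdCube d T)
    (s := Fintype.piFinset fun _ : Fin d => Finset.Ico (0 : ℤ) (⌈T / L⌉₊ : ℤ)) (fun x hx => by
      simp only [Set.mem_iUnion, exists_prop]
      refine exists_mem_latticeCell hL hpos fun i => ⟨?_, ?_⟩
      · simpa using hx.1 i
      · refine (hx.2 i).trans ?_
        rw [← div_le_iff₀ hL]
        exact_mod_cast Nat.le_ceil (T / L))
  rw [card_piFinset_Ico hpos.le] at this
  simpa using this

/-- Fekete's argument: the limit is the infimum over all `T > 0`. A near-optimal cube of side `L`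
tiles a cover of [0,T]^d by ⌈T/L⌉^d copies, and ⌈T/L⌉/T → 1/L. -/
theorem exists_tendsto_stdCube (hf : IsInvariantSubadditive f) :
    ∃ θ : ℝ, Tendsto (fun T => f (stdCube d T) / T ^ d) atTop (𝓝 θ) := by
  set S : Set ℝ := (fun T => f (stdCube d T) / T ^ d) '' Set.Ioi 0 with hS
  have hbdd : BddBelow S := ⟨0, by
    rintro _ ⟨T, hT, rfl⟩
    exact div_nonneg (hf.nonneg _) (pow_nonneg (le_of_lt hT) _)⟩
  have hne : S.Nonempty := ⟨_, 1, Set.mem_Ioi.2 one_pos, rfl⟩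
  refine ⟨sInf S, tendsto_order.2 ⟨fun a ha => ?_, fun a ha => ?_⟩⟩
  · filter_upwards [eventually_gt_atTop 0] with T hT
    exact ha.trans_le (csInf_le hbdd ⟨T, hT, rfl⟩)
  · obtain ⟨_, ⟨L, hL, rfl⟩, hLa⟩ := exists_lt_of_csInf_lt hne ha
    have hL' : (0 : ℝ) < L := hL
    have h1 : Tendsto (fun T : ℝ => ((⌈L⁻¹ * T⌉₊ : ℝ) / T) ^ d * f (stdCube d L)) atTop
        (𝓝 ((L⁻¹) ^ d * f (stdCube d L))) :=
      ((tendsto_nat_ceil_mul_div_atTop (inv_nonneg.2 hL'.le)).pow d).mul_const _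
    have h2 : (L⁻¹) ^ d * f (stdCube d L) < a := by
      rwa [inv_pow, inv_mul_eq_div]
    filter_upwards [h1.eventually (gt_mem_nhds h2), eventually_gt_atTop 0] with T hTa hT
    refine lt_of_le_of_lt ?_ hTa
    have := hf.stdCube_le hT hL'
    rw [div_pow, div_mul_eq_mul_div, inv_mul_eq_div]
    gcongr

/-- The upper bound covers `G` by the cells that meet it. The lower bound also needs only
subadditivity: a large cube, whose asymptotics are known, is covered by `G` and the cells not
contained in `G`, so `f (T • G)` is at least the large cube's value minus that of those cells. What
remains is `θ` times the internal measure. -/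
theorem tendsto_smul_div (hf : IsInvariantSubadditive f) {θ : ℝ}
    (hθ : Tendsto (fun T => f (stdCube d T) / T ^ d) atTop (𝓝 θ))
    {G : Set (Fin d → ℝ)} (hG : Bornology.IsBounded G) (hreg : HasRegularBoundary G) :
    Tendsto (fun T : ℝ => f (T • G) / T ^ d) atTop (𝓝 (θ * (volume G).toReal)) := by
  classical
  have hscale {c : ℝ} (hc : 0 < c) :
      Tendsto (fun T => f (stdCube d (T * c)) / T ^ d) atTop (𝓝 (c ^ d * θ)) := by
    have := (hθ.comp (tendsto_id.atTop_mul_const hc)).const_mul (c ^ d)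
    refine this.congr' ?_
    filter_upwards [eventually_gt_atTop 0] with T hT
    simp only [Function.comp_apply, id, mul_pow]
    field_simp
  have hbddsmul (T : ℝ) : Bornology.IsBounded (T • G) := hG.smul₀ T
  have hvol : volume G ≠ ⊤ := hG.measure_lt_top.ne
  have hint := (ENNReal.tendsto_toReal hvol).comp hreg.internal
  have hext := (ENNReal.tendsto_toReal hvol).comp hreg.external
  refine tendsto_order.2 ⟨fun a ha => ?_, fun a ha => ?_⟩
  · obtain ⟨δ, hδa, hδ⟩ := (((hint.const_mul θ).eventually (lt_mem_nhds ha)).and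
      self_mem_nhdsWithin).exists
    have hδ' : (0 : ℝ) < δ := hδ
    obtain ⟨M, hM, hMn⟩ := exists_index_bound hG hδ'
    set B := Fintype.piFinset fun _ : Fin d => Finset.Ico (-(M : ℤ)) M with hB
    set s := B.filter fun n => latticeCell δ n ⊆ G with hs
    have hsmem : ∀ n, n ∈ s ↔ latticeCell δ n ⊆ G := fun n => by
      rw [hs, Finset.mem_filter, and_iff_right_iff_imp]
      intro hn
      refine hMn n ?_
      rw [Set.inter_eq_left.2 hn]
      exact latticeCell_nonempty hδ'.le n
    have hsB : s ⊆ B := Finset.filter_subset _ _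
    rw [Function.comp_apply, toReal_internalLatticeMeasure hδ'.le hsmem] at hδa
    have hBc : (B.card : ℝ) = (2 * M : ℝ) ^ d := by
      rw [hB, card_piFinset_Ico (by omega)]
      push_cast
      ring
    have hM' : (0 : ℝ) < M := by exact_mod_cast hM
    have hlow : ∀ T : ℝ, 0 < T → f (stdCube d (T * (2 * M * δ))) ≤
        f (T • G) + ((2 * M : ℝ) ^ d - s.card) * f (stdCube d (T * δ)) := by
      intro T hT
      have hTδ : 0 < T * δ := mul_pos hT hδ'
      have hu := hf.biUnion_latticeCell_le (T * δ) (B \ s)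
      rw [Finset.cast_card_sdiff hsB, hBc] at hu
      -- The cube of side 2MTδ is centred at the origin, so that it is the union of the scaled cells
      -- indexed by `B`.
      rw [← hf.translate _ fun _ => -(M * (T * δ)), image_add_stdCube]
      refine ((hf.mono _ (T • G ∪ ⋃ n ∈ B \ s, latticeCell (T * δ) n) ?_
        ((hbddsmul T).union hu.1)).trans (hf.union_le _ _ (hbddsmul T) hu.1)).trans
        (by linarith [hu.2])
      intro x hx
      obtain ⟨n, hn, hxn⟩ := exists_mem_latticeCell hTδ (a := -(M : ℤ)) (b := M) (by omega)
        (x := x) (fun i => by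
          have e1 := hx.1 i
          have e2 := hx.2 i
          push_cast
          dsimp only at e1 e2
          constructor <;> nlinarith)
      by_cases hns : n ∈ s
      · left
        rw [← smul_latticeCell hT] at hxn
        exact Set.smul_set_mono ((hsmem n).1 hns) hxn
      · right
        simp only [Set.mem_iUnion, exists_prop]
        exact ⟨n, Finset.mem_sdiff.2 ⟨hn, hns⟩, hxn⟩
    have hlim := (hscale (c := 2 * M * δ) (by positivity)).sub
      ((hscale hδ').const_mul ((2 * M : ℝ) ^ d - s.card))
    have e : (2 * M * δ) ^ d * θ - ((2 * M : ℝ) ^ d - s.card) * (δ ^ d * θ) =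
        θ * (s.card * δ ^ d) := by
      rw [mul_pow _ δ]; ring
    rw [e] at hlim
    filter_upwards [hlim.eventually (lt_mem_nhds hδa), eventually_gt_atTop 0] with T hTa hT
    refine hTa.trans_le ?_
    have := hlow T hT
    rw [← mul_div_assoc, ← sub_div]
    gcongr
    linarith
  · obtain ⟨δ, hδa, hδ⟩ := (((hext.const_mul θ).eventually (gt_mem_nhds ha)).and
      self_mem_nhdsWithin).exists
    have hδ' : (0 : ℝ) < δ := hδ
    obtain ⟨M, hM, hMn⟩ := exists_index_bound hG hδ'
    set B := Fintype.piFinset fun _ : Fin d => Finset.Ico (-(M : ℤ)) M with hB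
    set s := B.filter fun n => (latticeCell δ n ∩ G).Nonempty with hs
    have hsmem : ∀ n, n ∈ s ↔ (latticeCell δ n ∩ G).Nonempty := fun n => by
      rw [hs, Finset.mem_filter, and_iff_right_iff_imp]
      exact hMn n
    rw [Function.comp_apply, toReal_externalLatticeMeasure hδ'.le hsmem] at hδa
    have hup : ∀ T : ℝ, 0 < T → f (T • G) ≤ s.card * f (stdCube d (T * δ)) := by
      intro T hT
      refine hf.le_card_mul ?_
      rintro _ ⟨x, hx, rfl⟩
      have hxn : x ∈ latticeCell δ fun i => ⌊x i / δ⌋ := fun i => by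
        have h1 := Int.floor_le (x i / δ)
        have h2 := Int.lt_floor_add_one (x i / δ)
        rw [le_div_iff₀ hδ'] at h1
        rw [div_lt_iff₀ hδ'] at h2
        constructor <;> nlinarith
      simp only [Set.mem_iUnion, exists_prop]
      refine ⟨_, (hsmem _).2 ⟨x, hxn, hx⟩, ?_⟩
      rw [← smul_latticeCell hT]
      exact Set.smul_mem_smul_set hxn
    have hlim := (hscale hδ').const_mul (s.card : ℝ)
    rw [← mul_assoc, mul_comm _ θ] at hlim
    filter_upwards [hlim.eventually (gt_mem_nhds hδa), eventually_gt_atTop 0] with T hTa hT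
    refine lt_of_le_of_lt ?_ hTa
    have := hup T hT
    rw [← mul_div_assoc]
    gcongr

end IsInvariantSubadditive

/-! ### Association of negative orthants of Gaussian vectors. -/

/-- If `V` is centred and independent of `(R, U)`, then a decreasing function of `R + V c` with
`c ≥ 0` is negatively correlated with `V`, even against a nonnegative weight `h (U)`. -/
theorem integral_indicator_mul_nonpos {Ω ι κ : Type*} [MeasurableSpace Ω] {P : Measure Ω}
    [IsProbabilityMeasure P] [Finite ι]
    {V : Ω → ℝ} {R : Ω → ι → ℝ} {U : Ω → κ → ℝ} {c : ι → ℝ} (hc : 0 ≤ c)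
    (hV : Measurable V) (hR : Measurable R) (hU : Measurable U)
    (hind : IndepFun V (fun ω => (R ω, U ω)) P) (hV0 : ∫ ω, V ω ∂P = 0)
    {A : Set (ι → ℝ)} (hA : IsLowerSet A) (hAm : MeasurableSet A)
    {h : (κ → ℝ) → ℝ} (hh : Measurable h) (hh0 : ∀ u, 0 ≤ h u)
    (hint : Integrable (fun ω => h (U ω) * V ω) P) :
    ∫ ω, A.indicator 1 (R ω + V ω • c) * (h (U ω) * V ω) ∂P ≤ 0 := by
  have hi : Measurable (A.indicator (1 : (ι → ℝ) → ℝ)) := measurable_one.indicator hAm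
  -- With `R` in place of `R + V • c`, independence and the zero mean of `V` make the integral
  -- vanish. The replacement is a pointwise comparison: the shift by `V • c` lowers the indicator
  -- where `V ≥ 0` and raises it where `V ≤ 0`.
  have key : ∫ ω, A.indicator 1 (R ω) * (h (U ω) * V ω) ∂P = 0 := by
    have h2 : IndepFun V (fun ω => A.indicator (1 : (ι → ℝ) → ℝ) (R ω) * h (U ω)) P := by
      have := hind.comp (φ := id)
        (ψ := fun p : (ι → ℝ) × (κ → ℝ) => A.indicator (1 : (ι → ℝ) → ℝ) p.1 * h p.2)
        measurable_id (by fun_prop)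
      exact this
    have := h2.integral_mul_eq_mul_integral hV.aestronglyMeasurable
      (by apply Measurable.aestronglyMeasurable; fun_prop)
    rw [hV0, zero_mul] at this
    rw [← this]
    congr 1
    ext ω
    simp only [Pi.mul_apply]
    ring
  have bd : ∀ x, ‖A.indicator (1 : (ι → ℝ) → ℝ) x‖ ≤ 1 := fun x => by
    by_cases hx : x ∈ A <;> simp [hx]
  rw [← key]
  refine integral_mono ?_ ?_ fun ω => ?_
  · refine hint.bdd_mul (c := 1) ?_ (ae_of_all _ fun ω => bd _)
    apply Measurable.aestronglyMeasurable; fun_prop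
  · refine hint.bdd_mul (c := 1) ?_ (ae_of_all _ fun ω => bd _)
    apply Measurable.aestronglyMeasurable; fun_prop
  · have hhω := hh0 (U ω)
    rcases le_total 0 (V ω) with hv | hv
    · refine mul_le_mul_of_nonneg_right ?_ (mul_nonneg hhω hv)
      by_cases h1 : R ω + V ω • c ∈ A
      · have h2 : R ω ∈ A := hA (by
          intro i; have := mul_nonneg hv (hc i); simpa using this) h1
        simp [h1, h2]
      · by_cases h2 : R ω ∈ A <;> simp [h1, h2]
    · refine mul_le_mul_of_nonpos_right ?_ (mul_nonpos_of_nonneg_of_nonpos hhω hv)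
      by_cases h1 : R ω ∈ A
      · have h2 : R ω + V ω • c ∈ A := hA (by
          intro i; have := mul_nonpos_of_nonpos_of_nonneg hv (hc i); simpa using this) h1
        simp [h1, h2]
      · by_cases h2 : R ω + V ω • c ∈ A <;> simp [h1, h2]

/-- Squaring removes the kink of the positive part, so exp(-a Σ (x_k⁺)²) is a differentiable
substitute for an orthant indicator. -/
theorem hasDerivAt_max_zero_sq (x : ℝ) :
    HasDerivAt (fun x : ℝ => (max x 0) ^ 2) (2 * max x 0) x := by
  rcases lt_trichotomy x 0 with h | rfl | h
  · rw [max_eq_right h.le, mul_zero]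
    refine (hasDerivAt_const x (0 : ℝ)).congr_of_eventuallyEq ?_
    filter_upwards [gt_mem_nhds h] with y hy
    simp [max_eq_right (le_of_lt hy)]
  · rw [hasDerivAt_iff_isLittleO]
    have : (fun x : ℝ => x ^ 2) =o[𝓝 0] fun x : ℝ => x := by
      simpa using Asymptotics.isLittleO_pow_id (𝕜 := ℝ) (n := 2) (by norm_num)
    refine (Asymptotics.IsBigO.of_bound 1 (Eventually.of_forall fun y => ?_)).trans_isLittleO
      (this.congr_right (g₂ := fun x => x - 0) (by simp))
    simp only [sub_zero, max_self, mul_zero, smul_zero, one_mul]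
    rcases le_total y 0 with h | h <;> simp [h, sq_nonneg]
  · rw [max_eq_left h.le]
    refine HasDerivAt.congr_of_eventuallyEq (f := fun x : ℝ => x ^ 2) ?_ ?_
    · simpa using hasDerivAt_pow 2 x
    · filter_upwards [lt_mem_nhds h] with y hy
      simp [max_eq_left (le_of_lt hy)]

section Association

variable {ι : Type*} [Fintype ι] {μ : Measure (ι → ℝ)} [IsGaussian μ]

theorem memLp_eval_of_isGaussian (i : ι) : MemLp (fun x : ι → ℝ => x i) 2 μ :=
  IsGaussian.memLp_dual μ (ContinuousLinearMap.proj (R := ℝ) (φ := fun _ : ι => ℝ) i) 2 (by simp)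

/-- Combinations of two independent copies with orthogonal coefficient vectors are uncorrelated;
this decouples the rotated vector from its derivative. -/
theorem covariance_linearComb_prod (i j : ι) (a b c d : ℝ) :
    cov[fun p : (ι → ℝ) × (ι → ℝ) => a * p.1 i + b * p.2 i, fun p => c * p.1 j + d * p.2 j;
      μ.prod μ] = (a * c + b * d) * cov[fun x => x i, fun x => x j; μ] := by
  have h1 (i) : MemLp (fun p : (ι → ℝ) × (ι → ℝ) => p.1 i) 2 (μ.prod μ) :=
    (memLp_eval_of_isGaussian (μ := μ) i).comp_fst μ
  have h2 (i) : MemLp (fun p : (ι → ℝ) × (ι → ℝ) => p.2 i) 2 (μ.prod μ) :=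
    (memLp_eval_of_isGaussian (μ := μ) i).comp_snd μ
  have e1 : cov[fun p : (ι → ℝ) × (ι → ℝ) => p.1 i, fun p => p.1 j; μ.prod μ]
      = cov[fun x => x i, fun x => x j; μ] := by
    have := covariance_map_fun (μ := μ.prod μ) (Z := Prod.fst) (X := fun x : ι → ℝ => x i)
      (Y := fun x : ι → ℝ => x j) (measurable_pi_apply i).aestronglyMeasurable
      (measurable_pi_apply j).aestronglyMeasurable (by fun_prop)
    rw [← this, Measure.map_fst_prod]; simp
  have e2 : cov[fun p : (ι → ℝ) × (ι → ℝ) => p.2 i, fun p => p.2 j; μ.prod μ]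
      = cov[fun x => x i, fun x => x j; μ] := by
    have := covariance_map_fun (μ := μ.prod μ) (Z := Prod.snd) (X := fun x : ι → ℝ => x i)
      (Y := fun x : ι → ℝ => x j) (measurable_pi_apply i).aestronglyMeasurable
      (measurable_pi_apply j).aestronglyMeasurable (by fun_prop)
    rw [← this, Measure.map_snd_prod]; simp
  have e3 : cov[fun p : (ι → ℝ) × (ι → ℝ) => p.1 i, fun p => p.2 j; μ.prod μ] = 0 :=
    covariance_fst_snd_prod (memLp_eval_of_isGaussian i) (memLp_eval_of_isGaussian j)
  have e4 : cov[fun p : (ι → ℝ) × (ι → ℝ) => p.2 i, fun p => p.1 j; μ.prod μ] = 0 := by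
    rw [covariance_comm]
    exact covariance_fst_snd_prod (memLp_eval_of_isGaussian j) (memLp_eval_of_isGaussian i)
  have := covariance_add_left (μ := μ.prod μ) ((h1 i).const_mul a) ((h2 i).const_mul b)
    (((h1 j).const_mul c).add ((h2 j).const_mul d))
  have s1 := covariance_add_right (μ := μ.prod μ) ((h1 i).const_mul a) ((h1 j).const_mul c)
    ((h2 j).const_mul d)
  have s2 := covariance_add_right (μ := μ.prod μ) ((h2 i).const_mul b) ((h1 j).const_mul c)
    ((h2 j).const_mul d)
  simp only [covariance_const_mul_left, covariance_const_mul_right, e1, e2, e3, e4] at this s1 s2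
  rw [s1, s2] at this
  refine this.trans ?_
  ring

/-- Each term of the derivative of the interpolation has a sign. -/
theorem integral_rotation_term_nonpos (h0 : ∀ i, ∫ x, x i ∂μ = 0)
    (h1 : ∀ i, cov[fun x => x i, fun x => x i; μ] = 1)
    (hcov : ∀ i j, 0 ≤ cov[fun x => x i, fun x => x j; μ])
    {A : Set (ι → ℝ)} (hA : IsLowerSet A) (hAm : MeasurableSet A)
    {h : (ι → ℝ) → ℝ} (hh : Measurable h) (hh0 : ∀ u, 0 ≤ h u) (s c : ℝ) (hc : 0 ≤ c)
    (hsc : s ^ 2 + c ^ 2 = 1) (j : ι)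
    (hint : Integrable (fun p : (ι → ℝ) × (ι → ℝ) =>
      h (fun k => s * p.1 k + c * p.2 k) * (c * p.1 j + -s * p.2 j)) (μ.prod μ)) :
    ∫ p : (ι → ℝ) × (ι → ℝ), A.indicator 1 p.1 *
      (h (fun k => s * p.1 k + c * p.2 k) * (c * p.1 j + -s * p.2 j)) ∂(μ.prod μ) ≤ 0 := by
  set V : (ι → ℝ) × (ι → ℝ) → ℝ := fun p => c * p.1 j + -s * p.2 j with hVdef
  set U : (ι → ℝ) × (ι → ℝ) → ι → ℝ := fun p k => s * p.1 k + c * p.2 k with hUdef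
  set C : ι → ℝ := fun i => c * cov[fun x => x i, fun x => x j; μ] with hC
  -- `R` is the residual of the first copy after regression on `V`, which has variance 1. The
  -- regression coefficients `C` are nonnegative because the covariances and `c` are.
  set R : (ι → ℝ) × (ι → ℝ) → ι → ℝ := fun p i => p.1 i - V p * C i with hR
  have m1 (i) : MemLp (fun p : (ι → ℝ) × (ι → ℝ) => p.1 i) 2 (μ.prod μ) :=
    (memLp_eval_of_isGaussian (μ := μ) i).comp_fst μ
  have m2 (i) : MemLp (fun p : (ι → ℝ) × (ι → ℝ) => p.2 i) 2 (μ.prod μ) :=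
    (memLp_eval_of_isGaussian (μ := μ) i).comp_snd μ
  have mV : MemLp V 2 (μ.prod μ) := ((m1 j).const_mul c).add ((m2 j).const_mul (-s))
  have hV0 : ∫ p, V p ∂(μ.prod μ) = 0 := by
    have i1 : Integrable (fun p : (ι → ℝ) × (ι → ℝ) => p.1 j) (μ.prod μ) :=
      (m1 j).integrable (by norm_num)
    have i2 : Integrable (fun p : (ι → ℝ) × (ι → ℝ) => p.2 j) (μ.prod μ) :=
      (m2 j).integrable (by norm_num)
    rw [hVdef, integral_add (i1.const_mul c) (i2.const_mul (-s)), integral_const_mul,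
      integral_const_mul, integral_fun_fst (f := fun x : ι → ℝ => x j),
      integral_fun_snd (f := fun x : ι → ℝ => x j), h0]
    simp
  have hVV : cov[V, V; μ.prod μ] = 1 := by
    rw [hVdef, covariance_linearComb_prod, h1]; linear_combination hsc
  -- By joint Gaussianity zero covariance suffices: with `R` by the choice of `C`, with `U` because
  -- (c, -s) and (s, c) are orthogonal.
  have hind : IndepFun V (fun p => (R p, U p)) (μ.prod μ) := by
    let L : (ι → ℝ) × (ι → ℝ) →ₗ[ℝ] (Unit → ℝ) × (ι ⊕ ι → ℝ) :=
      { toFun p := (fun _ => V p, Sum.elim (R p) (U p))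
        map_add' p q := by
          ext i
          · simp [V]; ring
          · rcases i with i | i <;> simp [V, R, U] <;> ring
        map_smul' a p := by
          ext i
          · simp [V]; ring
          · rcases i with i | i <;> simp [V, R, U] <;> ring }
    have hg : HasGaussianLaw (fun p => L p) (μ.prod μ) :=
      (IsGaussian.hasGaussianLaw_id (μ := μ.prod μ)).map_fun (LinearMap.toContinuousLinearMap L)
    have := HasGaussianLaw.indepFun_of_covariance_eval (X := fun (_ : Unit) p => V p)
      (Y := fun k p => Sum.elim (R p) (U p) k) hg (by
        rintro - (i | i)
        · have e1 : cov[V, fun p : (ι → ℝ) × (ι → ℝ) => p.1 i; μ.prod μ] = C i := by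
            have := covariance_linearComb_prod (μ := μ) j i c (-s) 1 0
            simp only [one_mul, zero_mul, add_zero, mul_one, mul_zero] at this
            rw [hC]; dsimp only; rw [covariance_comm (fun x : ι → ℝ => x i)]; exact this
          have e2 := covariance_sub_right (μ := μ.prod μ) mV (m1 i) (mV.mul_const (C i))
          have e3 : cov[V, fun p => V p * C i; μ.prod μ] = C i := by
            rw [covariance_mul_const_right, hVV, one_mul]
          rw [e1, e3, sub_self] at e2
          exact e2
        · have := covariance_linearComb_prod (μ := μ) j i c (-s) s c
          have e : c * s + -s * c = 0 := by ring
          rw [e, zero_mul] at this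
          exact this)
    have me : Measurable fun v : Unit → ℝ => v () := measurable_pi_apply _
    exact this.comp (φ := fun v => v ())
      (ψ := fun w : ι ⊕ ι → ℝ => (fun i => w (.inl i), fun i => w (.inr i)))
      me (by fun_prop)
  have := integral_indicator_mul_nonpos (c := C) (fun i => mul_nonneg hc (hcov i j))
    (by fun_prop) (by fun_prop) (by fun_prop) hind hV0 hA hAm hh hh0 hint
  have hRV : ∀ p, R p + V p • C = p.1 := fun p => by ext i; simp [R]
  simpa only [hRV] using this

end Association

theorem hasDerivAt_rotation {ι : Type*} (p : (ι → ℝ) × (ι → ℝ)) (B : Finset ι) (a θ : ℝ) :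
    HasDerivAt (fun θ => Real.exp (-(a * ∑ k ∈ B,
        (max (Real.sin θ * p.1 k + Real.cos θ * p.2 k) 0) ^ 2)))
      (-∑ k ∈ B, 2 * a * max (Real.sin θ * p.1 k + Real.cos θ * p.2 k) 0 *
        Real.exp (-(a * ∑ k ∈ B, (max (Real.sin θ * p.1 k + Real.cos θ * p.2 k) 0) ^ 2)) *
        (Real.cos θ * p.1 k + -Real.sin θ * p.2 k)) θ := by
  have h1 (k) : HasDerivAt (fun θ => (max (Real.sin θ * p.1 k + Real.cos θ * p.2 k) 0) ^ 2)
      (2 * max (Real.sin θ * p.1 k + Real.cos θ * p.2 k) 0 *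
        (Real.cos θ * p.1 k + -Real.sin θ * p.2 k)) θ :=
    (hasDerivAt_max_zero_sq _).comp θ
      (((Real.hasDerivAt_sin θ).mul_const _).add ((Real.hasDerivAt_cos θ).mul_const _))
  have h2 := ((HasDerivAt.fun_sum fun k (_ : k ∈ B) => h1 k).const_mul a).neg.exp
  refine h2.congr_deriv ?_
  change Real.exp (-(a * ∑ k ∈ B, (max (Real.sin θ * p.1 k + Real.cos θ * p.2 k) 0) ^ 2)) *
    -(a * ∑ k ∈ B, _) = _
  generalize Real.exp _ = E
  rw [mul_neg, ← mul_assoc, Finset.mul_sum, neg_inj]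
  exact Finset.sum_congr rfl fun k _ => by ring

theorem abs_linearComb_sq_le {s c x y : ℝ} (h : s ^ 2 + c ^ 2 = 1) :
    (s * x + c * y) ^ 2 ≤ x ^ 2 + y ^ 2 := by
  nlinarith [sq_nonneg (s * y - c * x)]

section Orthant

variable {ι : Type*} [Fintype ι] {μ : Measure (ι → ℝ)} [IsGaussian μ]

/-- The two sides are the values at θ = 0 and θ = π/2 of one function of the rotation angle. Its
derivative is minus a sum of the terms controlled by `integral_rotation_term_nonpos`, hence
nonnegative while cos θ ≥ 0. -/
theorem integral_rotation_le (h0 : ∀ i, ∫ x, x i ∂μ = 0)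
    (h1 : ∀ i, cov[fun x => x i, fun x => x i; μ] = 1)
    (hcov : ∀ i j, 0 ≤ cov[fun x => x i, fun x => x j; μ])
    {A : Set (ι → ℝ)} (hA : IsLowerSet A) (hAm : MeasurableSet A) (B : Finset ι)
    {a : ℝ} (ha : 0 ≤ a) :
    ∫ p : (ι → ℝ) × (ι → ℝ), A.indicator 1 p.1 *
        Real.exp (-(a * ∑ k ∈ B, (max (p.2 k) 0) ^ 2)) ∂(μ.prod μ) ≤
    ∫ p : (ι → ℝ) × (ι → ℝ), A.indicator 1 p.1 *
        Real.exp (-(a * ∑ k ∈ B, (max (p.1 k) 0) ^ 2)) ∂(μ.prod μ) := by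
  have hi : Measurable (A.indicator (1 : (ι → ℝ) → ℝ)) := measurable_one.indicator hAm
  set F : ℝ → (ι → ℝ) × (ι → ℝ) → ℝ := fun θ p => A.indicator 1 p.1 * Real.exp (-(a * ∑ k ∈ B,
        (max (Real.sin θ * p.1 k + Real.cos θ * p.2 k) 0) ^ 2)) with hF
  set w : ι → (ι → ℝ) → ℝ := fun k u => 2 * a * max (u k) 0 *
        Real.exp (-(a * ∑ k ∈ B, (max (u k) 0) ^ 2)) with hw
  have hw0 (k u) : 0 ≤ w k u := by rw [hw]; positivity
  have hwm (k) : Measurable (w k) := by rw [hw]; fun_prop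
  set F' : ℝ → (ι → ℝ) × (ι → ℝ) → ℝ := fun θ p => A.indicator 1 p.1 * -∑ k ∈ B,
    w k (fun i => Real.sin θ * p.1 i + Real.cos θ * p.2 i) *
      (Real.cos θ * p.1 k + -Real.sin θ * p.2 k) with hF'
  have bd : ∀ x, ‖A.indicator (1 : (ι → ℝ) → ℝ) x‖ ≤ 1 := fun x => by
    by_cases hx : x ∈ A <;> simp [hx]
  have hsq1 (k) : Integrable (fun p : (ι → ℝ) × (ι → ℝ) => p.1 k ^ 2) (μ.prod μ) :=
    ((memLp_eval_of_isGaussian (μ := μ) k).comp_fst μ).integrable_sq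
  have hsq2 (k) : Integrable (fun p : (ι → ℝ) × (ι → ℝ) => p.2 k ^ 2) (μ.prod μ) :=
    ((memLp_eval_of_isGaussian (μ := μ) k).comp_snd μ).integrable_sq
  -- A bound uniform in θ, integrable since Gaussian coordinates are square integrable; it justifies
  -- differentiation under the integral.
  have hterm (k) (θ : ℝ) (p : (ι → ℝ) × (ι → ℝ)) :
      ‖w k (fun i => Real.sin θ * p.1 i + Real.cos θ * p.2 i) *
      (Real.cos θ * p.1 k + -Real.sin θ * p.2 k)‖ ≤ 2 * a * (p.1 k ^ 2 + p.2 k ^ 2) := by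
    rw [norm_mul, Real.norm_eq_abs, Real.norm_eq_abs,
      abs_of_nonneg (hw0 k fun i => Real.sin θ * p.1 i + Real.cos θ * p.2 i)]
    set u := Real.sin θ * p.1 k + Real.cos θ * p.2 k with hu
    set v := Real.cos θ * p.1 k + -Real.sin θ * p.2 k with hv
    have e1 : w k (fun i => Real.sin θ * p.1 i + Real.cos θ * p.2 i) ≤ 2 * a * |u| := by
      rw [hw]
      have : Real.exp (-(a * ∑ k ∈ B,
          (max (Real.sin θ * p.1 k + Real.cos θ * p.2 k) 0) ^ 2)) ≤ 1 := by
        rw [Real.exp_le_one_iff]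
        have : 0 ≤ a * ∑ k ∈ B, (max (Real.sin θ * p.1 k + Real.cos θ * p.2 k) 0) ^ 2 := by
          positivity
        linarith
      refine (mul_le_of_le_one_right (by positivity) this).trans ?_
      gcongr
      exact max_le (le_abs_self _) (abs_nonneg _)
    have e2 : u ^ 2 ≤ p.1 k ^ 2 + p.2 k ^ 2 := abs_linearComb_sq_le (Real.sin_sq_add_cos_sq θ)
    have e3 : v ^ 2 ≤ p.1 k ^ 2 + p.2 k ^ 2 :=
      abs_linearComb_sq_le (by linear_combination Real.sin_sq_add_cos_sq θ)
    calc _ ≤ 2 * a * |u| * |v| := by gcongr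
      _ = 2 * a * (|u| * |v|) := by ring
      _ ≤ _ := by
        gcongr
        nlinarith [sq_nonneg (|u| - |v|), sq_abs u, sq_abs v]
  have hint (k) (θ : ℝ) : Integrable (fun p : (ι → ℝ) × (ι → ℝ) =>
      w k (fun i => Real.sin θ * p.1 i + Real.cos θ * p.2 i) *
      (Real.cos θ * p.1 k + -Real.sin θ * p.2 k)) (μ.prod μ) := by
    refine Integrable.mono' (((hsq1 k).add (hsq2 k)).const_mul (2 * a)) ?_
      (ae_of_all _ fun p => hterm k θ p)
    apply Measurable.aestronglyMeasurable; fun_prop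
  have hder (θ : ℝ) : HasDerivAt (fun θ => ∫ p, F θ p ∂(μ.prod μ))
      (∫ p, F' θ p ∂(μ.prod μ)) θ := by
    refine (hasDerivAt_integral_of_dominated_loc_of_deriv_le (μ := μ.prod μ) (s := Set.univ)
      (F := F) (F' := F') (bound := fun p => ∑ k ∈ B, 2 * a * (p.1 k ^ 2 + p.2 k ^ 2))
      univ_mem ?_ ?_ ?_ ?_ ?_ ?_).2
    · refine Eventually.of_forall fun θ => ?_
      apply Measurable.aestronglyMeasurable; fun_prop
    · refine Integrable.of_bound (C := 1) (by apply Measurable.aestronglyMeasurable; fun_prop)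
        (ae_of_all _ fun p => ?_)
      rw [hF]
      dsimp only
      rw [norm_mul]
      refine mul_le_one₀ (bd _) (norm_nonneg _) ?_
      rw [Real.norm_of_nonneg (Real.exp_pos _).le, Real.exp_le_one_iff, neg_nonpos]
      positivity
    · apply Measurable.aestronglyMeasurable; fun_prop
    · refine ae_of_all _ fun p θ _ => ?_
      rw [hF']
      dsimp only
      rw [norm_mul, norm_neg]
      refine (mul_le_of_le_one_left (norm_nonneg _) (bd _)).trans ((norm_sum_le _ _).trans ?_)
      exact Finset.sum_le_sum fun k _ => hterm k θ p
    · exact integrable_finsetSum _ fun k _ => ((hsq1 k).add (hsq2 k)).const_mul (2 * a)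
    · exact ae_of_all _ fun p θ _ => (hasDerivAt_rotation p B a θ).const_mul _
  have hnonneg (θ : ℝ) (hθ : 0 ≤ Real.cos θ) : 0 ≤ ∫ p, F' θ p ∂(μ.prod μ) := by
    have : ∫ p, F' θ p ∂(μ.prod μ) = -∑ k ∈ B, ∫ p : (ι → ℝ) × (ι → ℝ), A.indicator 1 p.1 *
        (w k (fun i => Real.sin θ * p.1 i + Real.cos θ * p.2 i) *
      (Real.cos θ * p.1 k + -Real.sin θ * p.2 k)) ∂(μ.prod μ) := by
      rw [← integral_finsetSum, ← integral_neg]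
      · congr 1; ext p; rw [hF']; dsimp only; rw [mul_neg, Finset.mul_sum]
      · intro k _
        refine (hint k θ).bdd_mul (c := 1) ?_ (ae_of_all _ fun ω => bd _)
        apply Measurable.aestronglyMeasurable; fun_prop
    rw [this, neg_nonneg]
    refine Finset.sum_nonpos fun k _ => ?_
    exact integral_rotation_term_nonpos h0 h1 hcov hA hAm (hwm k) (hw0 k) _ _ hθ
      (Real.sin_sq_add_cos_sq θ) k (hint k θ)
  have hmono : MonotoneOn (fun θ => ∫ p, F θ p ∂(μ.prod μ)) (Set.Icc 0 (Real.pi / 2)) := by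
    refine monotoneOn_of_deriv_nonneg (convex_Icc _ _)
      (fun θ _ => (hder θ).continuousAt.continuousWithinAt)
      (fun θ _ => (hder θ).differentiableAt.differentiableWithinAt) fun θ hθ => ?_
    rw [(hder θ).deriv]
    rw [interior_Icc] at hθ
    exact hnonneg θ (Real.cos_nonneg_of_mem_Icc ⟨by linarith [hθ.1, Real.pi_pos], hθ.2.le⟩)
  have := hmono ⟨le_rfl, by positivity⟩ ⟨by positivity, le_rfl⟩
    (by positivity : (0 : ℝ) ≤ Real.pi / 2)
  simpa [F] using this

/-- The negative orthants of a Gaussian vector with nonnegative covariances are positively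
correlated. -/
theorem measure_orthant_mul_le (h0 : ∀ i, ∫ x, x i ∂μ = 0)
    (h1 : ∀ i, cov[fun x => x i, fun x => x i; μ] = 1)
    (hcov : ∀ i j, 0 ≤ cov[fun x => x i, fun x => x j; μ]) (A B : Finset ι) :
    μ.real {x | ∀ i ∈ A, x i ≤ 0} * μ.real {x | ∀ i ∈ B, x i ≤ 0} ≤
      μ.real {x | (∀ i ∈ A, x i ≤ 0) ∧ ∀ i ∈ B, x i ≤ 0} := by
  set SA : Set (ι → ℝ) := {x | ∀ i ∈ A, x i ≤ 0} with hSA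
  set SB : Set (ι → ℝ) := {x | ∀ i ∈ B, x i ≤ 0} with hSB
  have meas (C : Finset ι) : MeasurableSet {x : ι → ℝ | ∀ i ∈ C, x i ≤ 0} := by
    have : {x : ι → ℝ | ∀ i ∈ C, x i ≤ 0} = ⋂ i ∈ C, {x | x i ≤ 0} := by ext; simp
    rw [this]
    exact Finset.measurableSet_biInter _ fun i _ =>
      measurableSet_le (measurable_pi_apply i) measurable_const
  have hAm : MeasurableSet SA := meas A
  have hBm : MeasurableSet SB := meas B
  have hA : IsLowerSet SA := fun x y hxy hx i hi => (hxy i).trans (hx i hi)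
  have hi : Measurable (SA.indicator (1 : (ι → ℝ) → ℝ)) := measurable_one.indicator hAm
  have bd : ∀ x, ‖SA.indicator (1 : (ι → ℝ) → ℝ) x‖ ≤ 1 := fun x => by
    by_cases hx : x ∈ SA <;> simp [hx]
  -- As `n → ∞` the penalty exp(-n Σ (x_k⁺)²) tends to the indicator of `SB`, and it is bounded by
  -- 1, so dominated convergence turns the smooth inequality into the one for orthants.
  have hlim (x : ι → ℝ) : Tendsto (fun n : ℕ => Real.exp (-((n : ℝ) * ∑ k ∈ B, (max (x k) 0) ^ 2)))
      atTop (𝓝 (SB.indicator 1 x)) := by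
    by_cases hx : x ∈ SB
    · have : ∑ k ∈ B, (max (x k) 0) ^ 2 = 0 :=
        Finset.sum_eq_zero fun k hk => by simp [hx k hk]
      simp [hx, this]
    · have hx' := hx
      simp only [hSB, Set.mem_ofPred_eq, not_forall, not_le] at hx
      obtain ⟨k, hk, hpos⟩ := hx
      have : 0 < ∑ k ∈ B, (max (x k) 0) ^ 2 :=
        Finset.sum_pos' (fun i _ => sq_nonneg _) ⟨k, hk, by rw [max_eq_left hpos.le]; positivity⟩
      simp only [Set.indicator_of_notMem hx']
      exact Real.tendsto_exp_neg_atTop_nhds_zero.comp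
        (tendsto_natCast_atTop_atTop.atTop_mul_const this)
  have hle (n : ℕ) (x : ι → ℝ) : ‖Real.exp (-((n : ℝ) * ∑ k ∈ B, (max (x k) 0) ^ 2))‖ ≤ 1 := by
    rw [Real.norm_of_nonneg (Real.exp_pos _).le, Real.exp_le_one_iff, neg_nonpos]
    positivity
  have step (n : ℕ) : μ.real SA * ∫ x, Real.exp (-((n : ℝ) * ∑ k ∈ B, (max (x k) 0) ^ 2)) ∂μ ≤
      ∫ x, SA.indicator 1 x * Real.exp (-((n : ℝ) * ∑ k ∈ B, (max (x k) 0) ^ 2)) ∂μ := by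
    have := integral_rotation_le h0 h1 hcov hA hAm B (Nat.cast_nonneg n : (0 : ℝ) ≤ n)
    rw [integral_prod_mul (f := SA.indicator 1)
      (g := fun x : ι → ℝ => Real.exp (-((n : ℝ) * ∑ k ∈ B, (max (x k) 0) ^ 2))),
      integral_fun_fst (f := fun x : ι → ℝ => SA.indicator 1 x *
        Real.exp (-((n : ℝ) * ∑ k ∈ B, (max (x k) 0) ^ 2))), integral_indicator_one hAm] at this
    simpa using this
  have l1 : Tendsto (fun n : ℕ => μ.real SA *
      ∫ x, Real.exp (-((n : ℝ) * ∑ k ∈ B, (max (x k) 0) ^ 2)) ∂μ) atTop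
      (𝓝 (μ.real SA * μ.real SB)) := by
    refine Tendsto.const_mul _ ?_
    rw [← integral_indicator_one hBm]
    refine tendsto_integral_of_dominated_convergence (fun _ => 1) (fun n => ?_)
      (integrable_const _) (fun n => ae_of_all _ (hle n)) (ae_of_all _ hlim)
    apply Measurable.aestronglyMeasurable; fun_prop
  have l2 : Tendsto (fun n : ℕ =>
      ∫ x, SA.indicator 1 x * Real.exp (-((n : ℝ) * ∑ k ∈ B, (max (x k) 0) ^ 2)) ∂μ) atTop
      (𝓝 (μ.real (SA ∩ SB))) := by
    rw [← integral_indicator_one (hAm.inter hBm)]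
    have : ∀ x, (SA ∩ SB).indicator (1 : (ι → ℝ) → ℝ) x = SA.indicator 1 x * SB.indicator 1 x :=
      fun x => by rw [Set.inter_indicator_one]; rfl
    simp_rw [this]
    refine tendsto_integral_of_dominated_convergence (fun _ => 1) (fun n => ?_)
      (integrable_const _) (fun n => ae_of_all _ fun x => ?_)
      (ae_of_all _ fun x => (hlim x).const_mul _)
    · apply Measurable.aestronglyMeasurable; fun_prop
    · rw [norm_mul]
      exact mul_le_one₀ (bd x) (norm_nonneg _) (hle n x)
  exact le_of_tendsto_of_tendsto' l1 l2 step

end Orthant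

/-! ### An exponential upper bound for orthant probabilities. -/

theorem integrable_exp_neg_of_nonneg {Ω : Type*} [MeasurableSpace Ω] {P : Measure Ω}
    [IsFiniteMeasure P] {f : Ω → ℝ} (hf : Measurable f) (h0 : ∀ ω, 0 ≤ f ω) :
    Integrable (fun ω => Real.exp (-f ω)) P := by
  refine Integrable.of_bound (C := 1) (by apply Measurable.aestronglyMeasurable; fun_prop)
    (ae_of_all _ fun ω => ?_)
  rw [Real.norm_of_nonneg (Real.exp_pos _).le, Real.exp_le_one_iff, neg_nonpos]
  exact h0 ω

/-- Jensen's inequality, obtained by integrating the tangent line of exp(-x) at the mean. -/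
theorem exp_neg_integral_le {Ω : Type*} [MeasurableSpace Ω] {P : Measure Ω}
    [IsProbabilityMeasure P] {f : Ω → ℝ} (hf : Measurable f) (h0 : ∀ ω, 0 ≤ f ω)
    (hi : Integrable f P) :
    Real.exp (-∫ ω, f ω ∂P) ≤ ∫ ω, Real.exp (-f ω) ∂P := by
  set m := ∫ ω, f ω ∂P with hm
  have h : ∫ ω, Real.exp (-m) * (1 + m - f ω) ∂P = Real.exp (-m) := by
    rw [integral_const_mul, integral_sub (integrable_const _) hi, ← hm]
    simp
  rw [← h]
  refine integral_mono (((integrable_const _).sub hi).const_mul _)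
    (integrable_exp_neg_of_nonneg hf h0) fun ω => ?_
  have := Real.add_one_le_exp (m - f ω)
  have e : Real.exp (-f ω) = Real.exp (-m) * Real.exp (m - f ω) := by
    rw [← Real.exp_add]; congr 1; ring
  dsimp only
  rw [e]
  gcongr
  linarith

/-- `E exp (-(g⁺)²)` for a standard Gaussian variable `g`. -/
noncomputable def gaussianPosExp : ℝ := ∫ x, Real.exp (-(max x 0) ^ 2) ∂(gaussianReal 0 1)

theorem gaussianPosExp_pos : 0 < gaussianPosExp :=
  integral_exp_pos (integrable_exp_neg_of_nonneg (by fun_prop) fun _ => sq_nonneg _)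

theorem gaussianPosExp_lt_one : gaussianPosExp < 1 := by
  have hi : Integrable (fun x : ℝ => Real.exp (-(max x 0) ^ 2)) (gaussianReal 0 1) :=
    integrable_exp_neg_of_nonneg (by fun_prop) fun _ => sq_nonneg _
  have h : 0 < ∫ x, (1 - Real.exp (-(max x 0) ^ 2)) ∂(gaussianReal 0 1) := by
    refine (integral_pos_iff_support_of_nonneg (f := fun x : ℝ => 1 - Real.exp (-(max x 0) ^ 2))
      (fun x => ?_) ((integrable_const _).sub hi)).2 ?_
    · simp only [Pi.zero_apply, sub_nonneg, Real.exp_le_one_iff, neg_nonpos]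
      exact sq_nonneg _
    · have hs : Set.Ioi 0 ⊆ Function.support fun x : ℝ => 1 - Real.exp (-(max x 0) ^ 2) := by
        intro x hx
        have hx' : (0 : ℝ) < x := hx
        have : Real.exp (-(max x 0) ^ 2) < 1 := by
          rw [Real.exp_lt_one_iff, max_eq_left hx'.le]
          have := pow_pos hx' 2
          linarith
        simp only [Function.mem_support]
        linarith
      refine lt_of_lt_of_le ?_ (measure_mono hs)
      rw [pos_iff_ne_zero]
      intro h0
      have := gaussianReal_absolutelyContinuous' 0 (one_ne_zero) h0
      simp at this
  rw [integral_sub (integrable_const _) hi] at h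
  simp only [integral_const, probReal_univ, smul_eq_mul, mul_one] at h
  unfold gaussianPosExp
  linarith

/-- A centred Gaussian of variance `v` is √v times a standard one, and √v ≥ 1 only enlarges the
positive part. -/
theorem integral_exp_neg_max_sq_le {v : NNReal} (hv : 1 ≤ v) :
    ∫ x, Real.exp (-(max x 0) ^ 2) ∂(gaussianReal 0 v) ≤ gaussianPosExp := by
  have hvr : (1 : ℝ) ≤ √v := Real.one_le_sqrt.2 (by exact_mod_cast hv)
  have e : gaussianReal 0 v = (gaussianReal 0 1).map (√(v : ℝ) * ·) := by
    rw [gaussianReal_map_const_mul]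
    congr 1
    · simp
    · ext; simp
  rw [e, integral_map (by fun_prop) (by apply Measurable.aestronglyMeasurable; fun_prop)]
  refine integral_mono (integrable_exp_neg_of_nonneg (by fun_prop) fun _ => sq_nonneg _)
    (integrable_exp_neg_of_nonneg (by fun_prop) fun _ => sq_nonneg _) fun x => ?_
  dsimp only
  rw [Real.exp_le_exp, neg_le_neg_iff]
  refine pow_le_pow_left₀ (le_max_right _ _) ?_ 2
  rcases le_total x 0 with h | h
  · rw [max_eq_right h]; exact le_max_right _ _
  · rw [max_eq_left h]
    exact (le_mul_of_one_le_left h hvr).trans (le_max_left _ _)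

/-- The Laplacian of a nonnegative symmetric weight matrix is positive semidefinite. -/
theorem posSemidef_laplacian {ι : Type*} [Fintype ι] [DecidableEq ι] {K : Matrix ι ι ℝ}
    (hs : ∀ i j, K i j = K j i) (h0 : ∀ i j, 0 ≤ K i j) :
    (Matrix.diagonal (fun i => ∑ j, K i j) - K).PosSemidef := by
  refine .of_dotProduct_mulVec_nonneg ?_ fun x => ?_
  · ext i j
    by_cases h : i = j
    · subst h; simp
    · simp [Matrix.diagonal_apply_ne _ h, Matrix.diagonal_apply_ne _ (Ne.symm h), hs i j]
  · have e : star x ⬝ᵥ (Matrix.diagonal (fun i => ∑ j, K i j) - K).mulVec x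
        = (∑ i, ∑ j, K i j * (x i - x j) ^ 2) / 2 := by
      have e1 : star x ⬝ᵥ (Matrix.diagonal (fun i => ∑ j, K i j) - K).mulVec x
          = ∑ i, ∑ j, (K i j * x i ^ 2 - K i j * (x i * x j)) := by
        have hd : (Matrix.diagonal fun i => ∑ j, K i j).mulVec x = fun i => (∑ j, K i j) * x i := by
          ext i; exact Matrix.mulVec_diagonal _ _ i
        rw [Matrix.sub_mulVec, dotProduct_sub, hd]
        simp only [dotProduct, Matrix.mulVec, star_trivial,
          Finset.sum_sub_distrib, Finset.mul_sum, Finset.sum_mul]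
        congr 1 <;> exact Finset.sum_congr rfl fun i _ => Finset.sum_congr rfl fun j _ => by ring
      have e2 : ∑ i, ∑ j, (K i j * x i ^ 2 - K i j * (x i * x j)) =
          ∑ i, ∑ j, (K i j * x j ^ 2 - K i j * (x i * x j)) := by
        rw [Finset.sum_comm]
        exact Finset.sum_congr rfl fun i _ => Finset.sum_congr rfl fun j _ => by
          rw [hs i j]; ring
      have e3 : ∑ i, ∑ j, K i j * (x i - x j) ^ 2 =
          ∑ i, ∑ j, (K i j * x i ^ 2 - K i j * (x i * x j)) +
          ∑ i, ∑ j, (K i j * x j ^ 2 - K i j * (x i * x j)) := by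
        simp only [← Finset.sum_add_distrib]
        exact Finset.sum_congr rfl fun i _ => Finset.sum_congr rfl fun j _ => by ring
      rw [e3, ← e2, e1]; ring
    rw [e]
    have : 0 ≤ ∑ i, ∑ j, K i j * (x i - x j) ^ 2 :=
      Finset.sum_nonneg fun i _ => Finset.sum_nonneg fun j _ => mul_nonneg (h0 i j) (sq_nonneg _)
    positivity

/-- Orthant probabilities of weakly correlated Gaussian vectors are exponentially small. -/
theorem measure_orthant_le {ι : Type*} [Fintype ι] {μ : Measure (ι → ℝ)} [IsGaussian μ]
    (h0 : ∀ i, ∫ x, x i ∂μ = 0) (h1 : ∀ i, cov[fun x => x i, fun x => x i; μ] = 1)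
    (hcov : ∀ i j, 0 ≤ cov[fun x => x i, fun x => x j; μ]) :
    μ.real {x | ∀ i, x i ≤ 0} ≤ gaussianPosExp ^ Fintype.card ι *
      Real.exp ((∑ i, ∑ j, cov[fun x => x i, fun x => x j; μ]) - Fintype.card ι) := by
  classical
  set K : Matrix ι ι ℝ := fun i j => cov[fun x => x i, fun x => x j; μ] with hK
  have hKs (i j) : K i j = K j i := covariance_comm _ _
  set S : Matrix ι ι ℝ := Matrix.diagonal (fun i => ∑ j, K i j) - K with hS
  have hSp : S.PosSemidef := posSemidef_laplacian hKs hcov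
  -- Independent noise with the Laplacian covariance `S`: since K + S is diagonal, the sum `Z` of
  -- the vector and the noise has independent coordinates, with variances equal to the row sums of
  -- `K`.
  set η := multivariateGaussian (0 : EuclideanSpace ℝ ι) S with hη
  -- The diagonal entry is 1 and the others are nonnegative, so every coordinate of `Z` has variance
  -- at least 1.
  have hD (i) : 1 ≤ ∑ j, K i j := by
    rw [← h1 i]
    exact Finset.single_le_sum (f := fun j => K i j) (fun j _ => hcov i j) (Finset.mem_univ i)
  have mη (i) : MemLp (fun x : EuclideanSpace ℝ ι => x i) 2 η :=
    IsGaussian.memLp_dual η (EuclideanSpace.proj (𝕜 := ℝ) i) 2 (by simp)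
  have cη (i j) : cov[fun x : EuclideanSpace ℝ ι => x i, fun x => x j; η] = S i j :=
    covariance_eval_multivariateGaussian hSp i j
  have zη (i) : ∫ x : EuclideanSpace ℝ ι, x i ∂η = 0 := by
    have := IsGaussian.integral_dual (μ := η) (EuclideanSpace.proj (𝕜 := ℝ) i)
    rw [integral_id_multivariateGaussian] at this
    simpa using this
  set ν := μ.prod η with hν
  set Z : ι → (ι → ℝ) × EuclideanSpace ℝ ι → ℝ := fun i p => p.1 i + p.2 i with hZ
  have m1 (i) : MemLp (fun p : (ι → ℝ) × EuclideanSpace ℝ ι => p.1 i) 2 ν :=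
    (memLp_eval_of_isGaussian (μ := μ) i).comp_fst η
  have m2 (i) : MemLp (fun p : (ι → ℝ) × EuclideanSpace ℝ ι => p.2 i) 2 ν :=
    (mη i).comp_snd μ
  have hZm (i) : Measurable (Z i) := by fun_prop
  have zZ (i) : ∫ p, Z i p ∂ν = 0 := by
    rw [hZ, integral_add ((m1 i).integrable (by norm_num)) ((m2 i).integrable (by norm_num)),
      integral_fun_fst (f := fun x : ι → ℝ => x i),
      integral_fun_snd (f := fun x : EuclideanSpace ℝ ι => x i), h0, zη]
    simp
  have cZ (i j) : cov[Z i, Z j; ν] = K i j + S i j := by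
    have e1 : cov[fun p : (ι → ℝ) × EuclideanSpace ℝ ι => p.1 i, fun p => p.1 j; ν] = K i j := by
      have := covariance_map_fun (μ := ν) (Z := Prod.fst) (X := fun x : ι → ℝ => x i)
        (Y := fun x : ι → ℝ => x j) (measurable_pi_apply i).aestronglyMeasurable
        (measurable_pi_apply j).aestronglyMeasurable (by fun_prop)
      rw [← this, hν, Measure.map_fst_prod]; simp [hK]
    have e2 : cov[fun p : (ι → ℝ) × EuclideanSpace ℝ ι => p.2 i, fun p => p.2 j; ν] = S i j := by
      have := covariance_map_fun (μ := ν) (Z := Prod.snd) (X := fun x : EuclideanSpace ℝ ι => x i)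
        (Y := fun x : EuclideanSpace ℝ ι => x j) (by apply Measurable.aestronglyMeasurable; fun_prop)
        (by apply Measurable.aestronglyMeasurable; fun_prop) (by fun_prop)
      rw [← this, hν, Measure.map_snd_prod]; simp [cη]
    have e3 (i j) : cov[fun p : (ι → ℝ) × EuclideanSpace ℝ ι => p.1 i, fun p => p.2 j; ν] = 0 :=
      covariance_fst_snd_prod (memLp_eval_of_isGaussian i) (mη j)
    have e4 := e3 j i
    rw [covariance_comm] at e4
    have := covariance_add_left (m1 i) (m2 i) ((m1 j).add (m2 j))
    rw [covariance_add_right (m1 i) (m1 j) (m2 j), covariance_add_right (m2 i) (m1 j) (m2 j),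
      e1, e2, e3, e4, add_zero, zero_add] at this
    exact this
  have gZ : HasGaussianLaw (fun p => (Z · p)) ν := by
    let L : (ι → ℝ) × EuclideanSpace ℝ ι →ₗ[ℝ] (ι → ℝ) :=
      { toFun p := fun i => Z i p
        map_add' p q := by ext i; simp [Z]; ring
        map_smul' a p := by ext i; simp [Z]; ring }
    exact (IsGaussian.hasGaussianLaw_id (μ := ν)).map_fun (LinearMap.toContinuousLinearMap L)
  have iZ : iIndepFun Z ν := gZ.iIndepFun_of_covariance_eq_zero fun i j hij => by
    rw [cZ, hS]; simp [Matrix.diagonal_apply_ne _ hij]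
  have lZ (i) : ν.map (Z i) = gaussianReal 0 (∑ j, K i j).toNNReal := by
    rw [(gZ.eval i).map_eq_gaussianReal, zZ, ← covariance_self (hZm i).aemeasurable, cZ]
    simp [hS]
  have bZ (i) : ∫ p, Real.exp (-(max (Z i p) 0) ^ 2) ∂ν ≤ gaussianPosExp := by
    have := integral_map (μ := ν) (hZm i).aemeasurable
      (f := fun x : ℝ => Real.exp (-(max x 0) ^ 2))
      (by apply Measurable.aestronglyMeasurable; fun_prop)
    rw [← this, lZ]
    exact integral_exp_neg_max_sq_le (by rw [Real.one_le_toNNReal]; exact hD i)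
  have prodZ : ∫ p, ∏ i, Real.exp (-(max (Z i p) 0) ^ 2) ∂ν ≤ gaussianPosExp ^ Fintype.card ι := by
    have := (iZ.comp (fun _ x => Real.exp (-(max x 0) ^ 2))
      (fun _ => by fun_prop)).integral_fun_prod_eq_prod_integral
      (fun i => by apply Measurable.aestronglyMeasurable; fun_prop)
    simp only [Function.comp_apply] at this
    rw [this]
    refine (Finset.prod_le_prod (fun i _ => ?_) fun i _ => bZ i).trans (by simp)
    exact integral_nonneg fun _ => (Real.exp_pos _).le
  set q : EuclideanSpace ℝ ι → ℝ := fun x => ∑ i, x i ^ 2 with hq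
  have hqm : Measurable q := by fun_prop
  have hq0 (x) : 0 ≤ q x := Finset.sum_nonneg fun i _ => sq_nonneg _
  have hqi : Integrable q η := integrable_finsetSum _ fun i _ => (mη i).integrable_sq
  have hqm' : ∫ x, q x ∂η = (∑ i, ∑ j, K i j) - Fintype.card ι := by
    rw [hq, integral_finsetSum _ fun i _ => (mη i).integrable_sq]
    have : ∀ i, ∫ x : EuclideanSpace ℝ ι, x i ^ 2 ∂η = ∑ j, K i j - 1 := fun i => by
      have e := cη i i
      rw [covariance_eq_sub (mη i) (mη i), zη, mul_zero, sub_zero] at e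
      have e' : S i i = ∑ j, K i j - 1 := by
        change Matrix.diagonal (fun i => ∑ j, K i j) i i - K i i = _
        rw [Matrix.diagonal_apply_eq, show K i i = 1 from h1 i]
      rw [← e', ← e]
      congr 1
      ext x
      simp [sq]
    simp [this]
  set O : Set (ι → ℝ) := {x | ∀ i, x i ≤ 0} with hO
  have hOm : MeasurableSet O := by
    have : O = ⋂ i, {x | x i ≤ 0} := by ext; simp [hO]
    rw [this]
    exact MeasurableSet.iInter fun i => measurableSet_le (measurable_pi_apply i) measurable_const
  have hOi : Measurable (O.indicator (1 : (ι → ℝ) → ℝ)) := measurable_one.indicator hOm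
  -- If the vector lies in the negative orthant, the positive part of each `Z i` is at most the
  -- absolute value of the noise. So 1_O · exp(-|noise|²) ≤ exp(-Σ (Z_i⁺)²), and both sides factor
  -- on integration. Jensen then bounds E exp(-|noise|²) below by exp(-tr S).
  have main : μ.real O * ∫ x, Real.exp (-q x) ∂η ≤ gaussianPosExp ^ Fintype.card ι := by
    refine le_trans ?_ prodZ
    rw [← integral_indicator_one hOm, ← integral_prod_mul (f := O.indicator 1)
      (g := fun x => Real.exp (-q x))]
    have hprod (p : (ι → ℝ) × EuclideanSpace ℝ ι) : ∏ i, Real.exp (-(max (Z i p) 0) ^ 2) =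
        Real.exp (-∑ i, (max (Z i p) 0) ^ 2) := by
      rw [← Real.exp_sum, Finset.sum_neg_distrib]
    simp_rw [hprod]
    refine integral_mono ?_ ?_ fun p => ?_
    · refine (integrable_exp_neg_of_nonneg (f := fun p : (ι → ℝ) × EuclideanSpace ℝ ι => q p.2)
        (by fun_prop) fun p => hq0 p.2).bdd_mul (c := 1) ?_ (ae_of_all _ fun p => ?_)
      · apply Measurable.aestronglyMeasurable; fun_prop
      · by_cases hp : p.1 ∈ O <;> simp [hp]
    · exact integrable_exp_neg_of_nonneg (by fun_prop)
        fun p => Finset.sum_nonneg fun i _ => sq_nonneg _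
    · by_cases hp : p.1 ∈ O
      · simp only [Set.indicator_of_mem hp, Pi.one_apply, one_mul]
        rw [Real.exp_le_exp, neg_le_neg_iff]
        refine Finset.sum_le_sum fun i _ => ?_
        have h2 : p.1 i ≤ 0 := hp i
        rw [← sq_abs (p.2 i)]
        refine pow_le_pow_left₀ (le_max_right _ _) (max_le ?_ (abs_nonneg _)) 2
        have := le_abs_self (p.2 i)
        simp only [hZ]
        linarith
      · simp only [Set.indicator_of_notMem hp, zero_mul]
        exact (Real.exp_pos _).le
  have jensen := exp_neg_integral_le hqm hq0 hqi
  rw [hqm'] at jensen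
  have h3 := (mul_le_mul_of_nonneg_left jensen (measureReal_nonneg (μ := μ) (s := O))).trans main
  rw [Real.exp_neg, ← div_eq_mul_inv, div_le_iff₀ (Real.exp_pos _)] at h3
  exact h3

/-! ### From finite-dimensional laws to the field. -/

section Field

variable {Ω : Type*} [MeasurableSpace Ω] {P : Measure Ω} {d : ℕ} {Y : (Fin d → ℝ) → Ω → ℝ}

theorem covariance_eq_fieldCov (hY_gauss : IsGaussianProcess Y P)
    (hY_homog : IsHomogeneousField Y P) (t s : Fin d → ℝ) :
    cov[Y t, Y s; P] = fieldCov Y P (t - s) := by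
  classical
  set I : Finset (Fin d → ℝ) := {t - s, 0} with hI
  have h := hY_homog s I
  have h1 : t - s ∈ I := by simp [hI]
  have h2 : 0 ∈ I := by simp [hI]
  have e1 : cov[fun x : I → ℝ => x ⟨t - s, h1⟩, fun x => x ⟨0, h2⟩;
      P.map (fun ω (t : I) => Y (t.1 + s) ω)] = cov[Y t, Y s; P] := by
    rw [covariance_map_fun (measurable_pi_apply _).aestronglyMeasurable
      (measurable_pi_apply _).aestronglyMeasurable
      (aemeasurable_pi_lambda _ fun i => hY_gauss.aemeasurable _)]
    simp
  have e2 : cov[fun x : I → ℝ => x ⟨t - s, h1⟩, fun x => x ⟨0, h2⟩;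
      P.map (fun ω (t : I) => Y t.1 ω)] = fieldCov Y P (t - s) := by
    rw [covariance_map_fun (measurable_pi_apply _).aestronglyMeasurable
      (measurable_pi_apply _).aestronglyMeasurable
      (aemeasurable_pi_lambda _ fun i => hY_gauss.aemeasurable _)]
    rfl
  rw [← e1, h, e2]

theorem isGaussian_map_family {ι : Type*} [Fintype ι] (hY_gauss : IsGaussianProcess Y P)
    (t : ι → Fin d → ℝ) : IsGaussian (P.map fun ω i => Y (t i) ω) := by
  let L : (↥(Finset.univ : Finset ι) → ℝ) →ₗ[ℝ] (ι → ℝ) :=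
    { toFun x i := x ⟨i, Finset.mem_univ i⟩
      map_add' x y := rfl
      map_smul' a x := rfl }
  exact (((hY_gauss.comp_right t).hasGaussianLaw Finset.univ).map_fun
    (LinearMap.toContinuousLinearMap L)).isGaussian_map

theorem integral_map_family {ι : Type*} [Fintype ι] (hY_gauss : IsGaussianProcess Y P)
    (hY_centered : ∀ t, ∫ ω, Y t ω ∂P = 0) (t : ι → Fin d → ℝ) (i : ι) :
    ∫ x, x i ∂(P.map fun ω i => Y (t i) ω) = 0 := by
  rw [integral_map (aemeasurable_pi_lambda _ fun i => hY_gauss.aemeasurable _)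
    (measurable_pi_apply i).aestronglyMeasurable, hY_centered]

theorem covariance_map_family {ι : Type*} [Fintype ι] (hY_gauss : IsGaussianProcess Y P)
    (hY_homog : IsHomogeneousField Y P) (t : ι → Fin d → ℝ) (i j : ι) :
    cov[fun x => x i, fun x => x j; P.map fun ω i => Y (t i) ω] = fieldCov Y P (t i - t j) := by
  rw [covariance_map_fun (measurable_pi_apply _).aestronglyMeasurable
    (measurable_pi_apply _).aestronglyMeasurable
    (aemeasurable_pi_lambda _ fun i => hY_gauss.aemeasurable _)]
  exact covariance_eq_fieldCov hY_gauss hY_homog _ _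

theorem measurableSet_forall_finset_nonpos {ι : Type*} (A : Finset ι) :
    MeasurableSet {x : ι → ℝ | ∀ i ∈ A, x i ≤ 0} := by
  have : {x : ι → ℝ | ∀ i ∈ A, x i ≤ 0} = ⋂ i ∈ A, {x | x i ≤ 0} := by ext; simp
  rw [this]
  exact Finset.measurableSet_biInter _ fun i _ =>
    measurableSet_le (measurable_pi_apply i) measurable_const

theorem persistenceProb_anti {A B : Set (Fin d → ℝ)} (h : A ⊆ B) :
    persistenceProb Y P B ≤ persistenceProb Y P A :=
  measure_mono fun _ hω t ht => hω t (h ht)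

theorem nullMeasurableSet_forall_nonpos (hm : ∀ t, AEMeasurable (Y t) P)
    {D : Set (Fin d → ℝ)} (hD : D.Countable) :
    NullMeasurableSet {ω | ∀ t ∈ D, Y t ω ≤ 0} P := by
  have : {ω | ∀ t ∈ D, Y t ω ≤ 0} = ⋂ t ∈ D, {ω | Y t ω ≤ 0} := by ext; simp
  rw [this]
  exact NullMeasurableSet.biInter hD fun t _ => nullMeasurableSet_le (hm t) aemeasurable_const

/-- Association of orthants, applied to the law of the field restricted to `F`. -/
theorem persistenceProb_union_finset (hY_gauss : IsGaussianProcess Y P)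
    (hY_centered : ∀ t, ∫ ω, Y t ω ∂P = 0) (hY_homog : IsHomogeneousField Y P)
    (hB_nonneg : ∀ t, 0 ≤ fieldCov Y P t) (hB_zero : fieldCov Y P 0 = 1)
    (A B F : Finset (Fin d → ℝ)) (hF : ∀ t, t ∈ F ↔ t ∈ A ∨ t ∈ B) :
    persistenceProb Y P A * persistenceProb Y P B ≤ persistenceProb Y P F := by
  classical
  have := hY_gauss.isProbabilityMeasure
  set μ := P.map fun ω (i : F) => Y i.1 ω with hμ
  have : IsGaussian μ := isGaussian_map_family hY_gauss _
  have hmeas : AEMeasurable (fun ω (i : F) => Y i.1 ω) P :=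
    aemeasurable_pi_lambda _ fun i => hY_gauss.aemeasurable _
  have key := measure_orthant_mul_le (μ := μ)
    (integral_map_family hY_gauss hY_centered _)
    (fun i => by rw [covariance_map_family hY_gauss hY_homog, sub_self, hB_zero])
    (fun i j => by rw [covariance_map_family hY_gauss hY_homog]; exact hB_nonneg _)
    (Finset.univ.filter fun i : F => i.1 ∈ A) (Finset.univ.filter fun i : F => i.1 ∈ B)
  have hC (C : Finset (Fin d → ℝ)) (hCF : C ⊆ F) :
      μ {x | ∀ i ∈ Finset.univ.filter (fun i : F => i.1 ∈ C), x i ≤ 0} = persistenceProb Y P C := by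
    rw [hμ, Measure.map_apply_of_aemeasurable hmeas (measurableSet_forall_finset_nonpos _)]
    unfold persistenceProb
    congr 1
    ext ω
    simp only [Finset.mem_filter, Finset.mem_univ, true_and, Set.mem_preimage, Set.mem_ofPred_eq,
      Finset.mem_coe]
    exact ⟨fun h t ht => h ⟨t, hCF ht⟩ ht, fun h i hi => h i.1 hi⟩
  have hAB : μ {x | (∀ i ∈ Finset.univ.filter (fun i : F => i.1 ∈ A), x i ≤ 0) ∧
      ∀ i ∈ Finset.univ.filter (fun i : F => i.1 ∈ B), x i ≤ 0} = persistenceProb Y P F := by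
    have hm2 : MeasurableSet {x : F → ℝ | (∀ i ∈ Finset.univ.filter (fun i : F => i.1 ∈ A), x i ≤ 0) ∧
        ∀ i ∈ Finset.univ.filter (fun i : F => i.1 ∈ B), x i ≤ 0} :=
      (measurableSet_forall_finset_nonpos _).inter (measurableSet_forall_finset_nonpos _)
    rw [hμ, Measure.map_apply_of_aemeasurable hmeas hm2]
    unfold persistenceProb
    congr 1
    ext ω
    simp only [Finset.mem_filter, Finset.mem_univ, true_and, Set.mem_preimage, Set.mem_ofPred_eq,
      Finset.mem_coe]
    refine ⟨fun h t ht => ?_, fun h => ⟨fun i _ => h i.1 i.2, fun i _ => h i.1 i.2⟩⟩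
    rcases (hF t).1 ht with h' | h'
    · exact h.1 ⟨t, ht⟩ h'
    · exact h.2 ⟨t, ht⟩ h'
  unfold Measure.real at key
  rw [hC A fun t ht => (hF t).2 (Or.inl ht), hC B fun t ht => (hF t).2 (Or.inr ht), hAB,
    ← ENNReal.toReal_mul] at key
  exact (ENNReal.toReal_le_toReal (ENNReal.mul_ne_top (measure_ne_top _ _) (measure_ne_top _ _))
    (measure_ne_top _ _)).1 key

theorem persistenceProb_translate_finset (hY_gauss : IsGaussianProcess Y P)
    (hY_homog : IsHomogeneousField Y P) (F : Finset (Fin d → ℝ)) (h : Fin d → ℝ) :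
    persistenceProb Y P ((fun x => x + h) '' F) = persistenceProb Y P F := by
  have hS : MeasurableSet {x : F → ℝ | ∀ i ∈ (Finset.univ : Finset F), x i ≤ 0} :=
    measurableSet_forall_finset_nonpos _
  have e := congrArg (fun μ => μ {x : F → ℝ | ∀ i ∈ (Finset.univ : Finset F), x i ≤ 0})
    (hY_homog h F)
  rw [Measure.map_apply_of_aemeasurable
      (aemeasurable_pi_lambda _ fun i => hY_gauss.aemeasurable _) hS,
    Measure.map_apply_of_aemeasurable
      (aemeasurable_pi_lambda _ fun i => hY_gauss.aemeasurable _) hS] at e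
  unfold persistenceProb
  simp only [Set.forall_mem_image]
  simpa [Set.preimage] using e

/-- The persistence probability of a continuous field is a limit over finite subsets. -/
theorem exists_finset_tendsto_persistenceProb [IsProbabilityMeasure P]
    (hm : ∀ t, AEMeasurable (Y t) P)
    (hY_cont : ∀ᵐ ω ∂P, Continuous (fun t => Y t ω)) (A : Set (Fin d → ℝ)) :
    ∃ F : ℕ → Finset (Fin d → ℝ), (∀ n, (F n : Set (Fin d → ℝ)) ⊆ A) ∧
      Tendsto (fun n => persistenceProb Y P (F n)) atTop (𝓝 (persistenceProb Y P A)) := by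
  classical
  obtain ⟨D, hDA, hDc, hDd⟩ := TopologicalSpace.IsSeparable.of_separableSpace A
    |>.exists_countable_dense_subset
  -- Almost every path is continuous, so nonpositivity on a dense subset of `A` extends to `A`. No
  -- measurability of `A` is needed.
  have hD : persistenceProb Y P D = persistenceProb Y P A := by
    refine le_antisymm ?_ (persistenceProb_anti hDA)
    refine measure_mono_ae ?_
    filter_upwards [hY_cont] with ω hω hωD t ht
    have hcl : IsClosed {t | Y t ω ≤ 0} := isClosed_le hω continuous_const
    exact closure_minimal (fun s hs => hωD s hs) hcl (hDd ht)
  rcases D.eq_empty_or_nonempty with hDe | hDne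
  · refine ⟨fun _ => ∅, fun n => by simp, ?_⟩
    rw [← hD, hDe]
    simp
  obtain ⟨e, he⟩ := hDc.exists_eq_range hDne
  refine ⟨fun n => (Finset.range n).image e, fun n => ?_, ?_⟩
  · intro x hx
    simp only [Finset.coe_image, Set.mem_image] at hx
    obtain ⟨k, -, rfl⟩ := hx
    exact hDA (he ▸ Set.mem_range_self k)
  · have := tendsto_measure_iInter_atTop (μ := P)
      (s := fun n : ℕ => {ω | ∀ t ∈ (((Finset.range n).image e : Finset _) : Set (Fin d → ℝ)),
        Y t ω ≤ 0})
      (fun n => nullMeasurableSet_forall_nonpos hm (Finset.countable_toSet _))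
      (fun m n hmn ω hω t ht => hω t
        (Finset.coe_subset.2 (Finset.image_subset_image (Finset.range_mono hmn)) ht))
      ⟨0, measure_ne_top _ _⟩
    rw [← hD]
    convert! this using 2
    unfold persistenceProb
    congr 1
    ext ω
    simp only [Set.mem_ofPred_eq, Set.mem_iInter, he, Set.forall_mem_range, Finset.coe_image,
      Set.forall_mem_image, Finset.coe_range, Set.mem_Iio]
    exact ⟨fun h n k _ => h k, fun h k => h (k + 1) (Nat.lt_succ_self k)⟩

end Field

/-! ### The persistence probability as a set function. -/

section Persistence

variable {Ω : Type*} [MeasurableSpace Ω] {P : Measure Ω} {d : ℕ} {Y : (Fin d → ℝ) → Ω → ℝ}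

/-- Only `A ∪ B` is approximated by finite sets; each one splits into its points in `A` and in `B`,
where persistence is at least as likely as on all of `A` or `B`. -/
theorem persistenceProb_union (hY_gauss : IsGaussianProcess Y P)
    (hY_cont : ∀ᵐ ω ∂P, Continuous (fun t => Y t ω))
    (hY_centered : ∀ t, ∫ ω, Y t ω ∂P = 0) (hY_homog : IsHomogeneousField Y P)
    (hB_nonneg : ∀ t, 0 ≤ fieldCov Y P t) (hB_zero : fieldCov Y P 0 = 1)
    (A B : Set (Fin d → ℝ)) :
    persistenceProb Y P A * persistenceProb Y P B ≤ persistenceProb Y P (A ∪ B) := by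
  classical
  have := hY_gauss.isProbabilityMeasure
  obtain ⟨F, hF, hlim⟩ :=
    exists_finset_tendsto_persistenceProb hY_gauss.aemeasurable hY_cont (A ∪ B)
  refine ge_of_tendsto' hlim fun n => ?_
  refine le_trans ?_ (persistenceProb_union_finset hY_gauss hY_centered hY_homog hB_nonneg hB_zero
    ((F n).filter (· ∈ A)) ((F n).filter (· ∈ B)) (F n) fun t => ?_)
  · exact mul_le_mul' (persistenceProb_anti fun t ht => (Finset.mem_filter.1 ht).2)
      (persistenceProb_anti fun t ht => (Finset.mem_filter.1 ht).2)
  · simp only [Finset.mem_filter, ← and_or_left, iff_self_and]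
    exact fun ht => hF n ht

theorem persistenceProb_translate (hY_gauss : IsGaussianProcess Y P)
    (hY_cont : ∀ᵐ ω ∂P, Continuous (fun t => Y t ω)) (hY_homog : IsHomogeneousField Y P)
    (A : Set (Fin d → ℝ)) (h : Fin d → ℝ) :
    persistenceProb Y P ((fun x => x + h) '' A) = persistenceProb Y P A := by
  have := hY_gauss.isProbabilityMeasure
  have key (A : Set (Fin d → ℝ)) (h : Fin d → ℝ) :
      persistenceProb Y P ((fun x => x + h) '' A) ≤ persistenceProb Y P A := by
    obtain ⟨F, hF, hlim⟩ := exists_finset_tendsto_persistenceProb hY_gauss.aemeasurable hY_cont A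
    refine ge_of_tendsto' hlim fun n => ?_
    rw [← persistenceProb_translate_finset hY_gauss hY_homog (F n) h]
    exact persistenceProb_anti (Set.image_mono (hF n))
  refine le_antisymm (key A h) ?_
  have := key ((fun x => x + h) '' A) (-h)
  rw [← Set.image_comp] at this
  simpa [Function.comp_def] using this

/-- An almost surely nonnegative variable with mean zero vanishes almost surely, hence has no
variance. -/
theorem measure_neg_pos_of_centered {X : Ω → ℝ} (hX : Integrable X P) (h0 : ∫ ω, X ω ∂P = 0)
    (hv : cov[X, X; P] ≠ 0) : 0 < P {ω | X ω < 0} := by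
  rw [pos_iff_ne_zero]
  intro h
  have hn : 0 ≤ᵐ[P] X := by
    rw [EventuallyLE, ae_iff]
    simpa using h
  have h1 := (integral_eq_zero_iff_of_nonneg_ae hn hX).1 h0
  apply hv
  rw [covariance, h0]
  refine integral_eq_zero_of_ae ?_
  filter_upwards [h1] with ω hω
  simp [hω]

/-- On the event Y(0) < 0, which has positive probability, continuity keeps the path negative on
some cube of side 1/(n+1); countably many null events cannot cover it. -/
theorem exists_persistenceProb_stdCube_pos (hY_gauss : IsGaussianProcess Y P)
    (hY_cont : ∀ᵐ ω ∂P, Continuous (fun t => Y t ω))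
    (hY_centered : ∀ t, ∫ ω, Y t ω ∂P = 0) (hB_zero : fieldCov Y P 0 = 1) :
    ∃ δ > 0, 0 < persistenceProb Y P (stdCube d δ) := by
  by_contra! h
  have h1 : 0 < P {ω | Y 0 ω < 0} :=
    measure_neg_pos_of_centered (hY_gauss.hasGaussianLaw_eval 0).integrable (hY_centered 0) (by
      change fieldCov Y P 0 ≠ 0
      rw [hB_zero]; exact one_ne_zero)
  have h2 : P (⋃ n : ℕ, {ω | ∀ t ∈ stdCube d (1 / ((n : ℝ) + 1)), Y t ω ≤ 0}) = 0 :=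
    measure_iUnion_null fun n => le_antisymm (h _ Nat.one_div_pos_of_nat) bot_le
  refine h1.ne' (le_antisymm ((measure_mono_ae ?_).trans h2.le) bot_le)
  filter_upwards [hY_cont] with ω hω hneg
  have h3 : ∀ᶠ t in 𝓝 (0 : Fin d → ℝ), Y t ω < 0 := hω.continuousAt.eventually (gt_mem_nhds hneg)
  obtain ⟨ε, hε, hball⟩ := Metric.eventually_nhds_iff.1 h3
  obtain ⟨n, hn⟩ := exists_nat_one_div_lt hε
  refine Set.mem_iUnion.2 ⟨n, fun t ht => (hball ?_).le⟩
  rw [dist_zero_right]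
  refine lt_of_le_of_lt ((pi_norm_le_iff_of_nonneg Nat.one_div_pos_of_nat.le).2 fun i => ?_) hn
  rw [Real.norm_of_nonneg (ht.1 i)]
  exact ht.2 i

/-- A bounded set is covered by finitely many translates of one cube of positive persistence
probability, and association bounds the probability on the union below by the product. -/
theorem persistenceProb_pos (hY_gauss : IsGaussianProcess Y P)
    (hY_cont : ∀ᵐ ω ∂P, Continuous (fun t => Y t ω))
    (hY_centered : ∀ t, ∫ ω, Y t ω ∂P = 0) (hY_homog : IsHomogeneousField Y P)
    (hB_nonneg : ∀ t, 0 ≤ fieldCov Y P t) (hB_zero : fieldCov Y P 0 = 1)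
    {A : Set (Fin d → ℝ)} (hA : Bornology.IsBounded A) : 0 < persistenceProb Y P A := by
  classical
  have := hY_gauss.isProbabilityMeasure
  obtain ⟨δ, hδ, hpos⟩ :=
    exists_persistenceProb_stdCube_pos hY_gauss hY_cont hY_centered hB_zero
  have hfin (s : Finset (Fin d → ℤ)) : 0 < persistenceProb Y P (⋃ n ∈ s, latticeCell δ n) := by
    induction s using Finset.induction_on with
    | empty => simp [persistenceProb]
    | insert n s hn ih =>
      rw [Finset.set_biUnion_insert]
      refine lt_of_lt_of_le (ENNReal.mul_pos ?_ ih.ne')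
        (persistenceProb_union hY_gauss hY_cont hY_centered hY_homog hB_nonneg hB_zero _ _)
      rw [latticeCell_eq_image, persistenceProb_translate hY_gauss hY_cont hY_homog]
      exact hpos.ne'
  obtain ⟨r, hr⟩ := hA.subset_closedBall 0
  set M : ℕ := ⌈r / δ⌉₊ + 1 with hM
  refine (hfin (Fintype.piFinset fun _ => Finset.Ico (-(M : ℤ)) M)).trans_le
    (persistenceProb_anti fun x hx => ?_)
  simp only [Set.mem_iUnion, exists_prop]
  refine exists_mem_latticeCell hδ (by omega) fun i => ?_
  have h1 : |x i| ≤ r := by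
    have h2 := hr hx
    rw [mem_closedBall_zero_iff] at h2
    exact (norm_le_pi_norm x i).trans h2
  have h3 : r ≤ ⌈r / δ⌉₊ * δ := by
    rw [← div_le_iff₀ hδ]; exact Nat.le_ceil _
  have h2 := abs_le.1 h1
  push_cast [hM]
  constructor <;> nlinarith

/-- The logarithm turns association into subadditivity. Positivity on bounded sets keeps the
convention `Real.log 0 = 0` from interfering, which is why monotonicity and subadditivity are asked
only there. -/
theorem isInvariantSubadditive_neg_log_persistenceProb (hY_gauss : IsGaussianProcess Y P)
    (hY_cont : ∀ᵐ ω ∂P, Continuous (fun t => Y t ω))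
    (hY_centered : ∀ t, ∫ ω, Y t ω ∂P = 0) (hY_homog : IsHomogeneousField Y P)
    (hB_nonneg : ∀ t, 0 ≤ fieldCov Y P t) (hB_zero : fieldCov Y P 0 = 1) :
    IsInvariantSubadditive fun A => -Real.log (persistenceProb Y P A).toReal := by
  have := hY_gauss.isProbabilityMeasure
  have hpos {A : Set (Fin d → ℝ)} (hA : Bornology.IsBounded A) :
      0 < (persistenceProb Y P A).toReal :=
    ENNReal.toReal_pos (persistenceProb_pos hY_gauss hY_cont hY_centered hY_homog hB_nonneg
      hB_zero hA).ne' (measure_ne_top _ _)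
  refine ⟨fun A => ?_, ?_, fun A B hAB hB => ?_, fun A B hA hB => ?_, fun A h => ?_⟩
  · rw [neg_nonneg]
    exact Real.log_nonpos ENNReal.toReal_nonneg measureReal_le_one
  · simp [persistenceProb]
  · refine neg_le_neg (Real.log_le_log (hpos hB) ?_)
    exact ENNReal.toReal_mono (measure_ne_top _ _) (persistenceProb_anti hAB)
  · have h1 := persistenceProb_union hY_gauss hY_cont hY_centered hY_homog hB_nonneg hB_zero A B
    have h2 : _ ≤ (persistenceProb Y P (A ∪ B)).toReal := ENNReal.toReal_mono (measure_ne_top _ _) h1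
    rw [ENNReal.toReal_mul] at h2
    have h3 := Real.log_le_log (mul_pos (hpos hA) (hpos hB)) h2
    rw [Real.log_mul (hpos hA).ne' (hpos hB).ne'] at h3
    linarith
  · rw [persistenceProb_translate hY_gauss hY_cont hY_homog]

theorem hasPersistenceExponent_of_tendsto [IsProbabilityMeasure P] {G : Set (Fin d → ℝ)} {θ : ℝ}
    (hpos : ∀ T : ℝ, persistenceProb Y P (T • G) ≠ 0)
    (h : Tendsto (fun T : ℝ => -Real.log (persistenceProb Y P (T • G)).toReal / T ^ d) atTop
      (𝓝 θ)) : HasPersistenceExponent Y P G θ := by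
  refine ((continuous_coe_real_ereal.tendsto θ).comp h).congr fun T => ?_
  rw [ENNReal.log_pos_real (hpos T) (measure_ne_top _ _), Function.comp_apply, EReal.coe_div,
    EReal.coe_neg]

end Persistence

/-! ### Strict positivity for an integrable covariance. -/

section Positivity

variable {d : ℕ}

/-- Points chosen one after another in `Q` so that the total interaction stays small. -/
theorem exists_points_sum_le {B : (Fin d → ℝ) → ℝ} (hB : Integrable B volume) (h0 : ∀ x, 0 ≤ B x)
    (hs : ∀ x, B (-x) = B x) {Q : Set (Fin d → ℝ)} (hQ0 : volume Q ≠ 0) (hQ : volume Q ≠ ⊤)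
    {ε : ℝ} {N : ℕ} (hN : N * ∫ x, B x ≤ ε * volume.real Q) (k : ℕ) (hk : k ≤ N) :
    ∃ t : ℕ → Fin d → ℝ, (∀ i < k, t i ∈ Q) ∧
      ∑ i ∈ Finset.range k, ∑ j ∈ Finset.range k, B (t i - t j) ≤ k * (B 0 + 2 * ε) := by
  induction k with
  | zero => exact ⟨0, by simp, by simp⟩
  | succ k ih =>
    obtain ⟨t, htQ, ht⟩ := ih (by omega)
    have hBi (j) : Integrable (fun x => B (x - t j)) volume := hB.comp_sub_right (t j)
    have hi : Integrable (fun x => ∑ j ∈ Finset.range k, B (x - t j)) volume :=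
      integrable_finsetSum _ fun j _ => hBi j
    -- The new point is one where the interaction with the earlier points is at most its mean over
    -- `Q`, and that mean is at most k ∫B / |Q| ≤ ε. By symmetry of `B` the double sum then grows by
    -- at most B(0) + 2ε.
    obtain ⟨x, hxQ, hx⟩ := exists_le_setAverage hQ0 hQ hi.integrableOn
    have hIB : 0 ≤ ∫ x, B x := integral_nonneg h0
    have hQpos : 0 < volume.real Q := ENNReal.toReal_pos hQ0 hQ
    have hxε : ∑ j ∈ Finset.range k, B (x - t j) ≤ ε := by
      refine hx.trans ?_
      rw [setAverage_eq, smul_eq_mul, inv_mul_le_iff₀ hQpos, mul_comm _ ε]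
      refine le_trans ?_ hN
      refine (setIntegral_le_integral hi (ae_of_all _ fun x =>
        Finset.sum_nonneg fun j _ => h0 _)).trans ?_
      rw [integral_finsetSum _ fun j _ => hBi j]
      simp only [integral_sub_right_eq_self (μ := volume) B, Finset.sum_const, Finset.card_range,
        nsmul_eq_mul]
      gcongr
      omega
    refine ⟨Function.update t k x, fun i hi => ?_, ?_⟩
    · rcases Nat.lt_succ_iff_lt_or_eq.1 hi with h | rfl
      · rw [Function.update_of_ne h.ne]; exact htQ i h
      · simpa using hxQ
    · have hu {i : ℕ} (hi : i ∈ Finset.range k) : Function.update t k x i = t i :=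
        Function.update_of_ne (Finset.mem_range.1 hi).ne _ _
      simp only [Finset.sum_range_succ, Finset.sum_add_distrib, Function.update_self, sub_self]
      have e1 : ∑ i ∈ Finset.range k, ∑ j ∈ Finset.range k,
          B (Function.update t k x i - Function.update t k x j) =
          ∑ i ∈ Finset.range k, ∑ j ∈ Finset.range k, B (t i - t j) :=
        Finset.sum_congr rfl fun i hi => Finset.sum_congr rfl fun j hj => by rw [hu hi, hu hj]
      have e2 : ∑ i ∈ Finset.range k, B (Function.update t k x i - x) =
          ∑ i ∈ Finset.range k, B (x - t i) :=
        Finset.sum_congr rfl fun i hi => by rw [hu hi, ← hs, neg_sub]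
      have e3 : ∑ i ∈ Finset.range k, B (x - Function.update t k x i) =
          ∑ i ∈ Finset.range k, B (x - t i) :=
        Finset.sum_congr rfl fun i hi => by rw [hu hi]
      rw [e1, e2, e3]
      push_cast
      linarith

variable {Ω : Type*} [MeasurableSpace Ω] {P : Measure Ω} {Y : (Fin d → ℝ) → Ω → ℝ}

theorem persistenceProb_le_of_points (hY_gauss : IsGaussianProcess Y P)
    (hY_centered : ∀ t, ∫ ω, Y t ω ∂P = 0) (hY_homog : IsHomogeneousField Y P)
    (hB_nonneg : ∀ t, 0 ≤ fieldCov Y P t) (hB_zero : fieldCov Y P 0 = 1)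
    {A : Set (Fin d → ℝ)} {N : ℕ} (t : Fin N → Fin d → ℝ) (ht : ∀ i, t i ∈ A) :
    (persistenceProb Y P A).toReal ≤ gaussianPosExp ^ N *
      Real.exp ((∑ i, ∑ j, fieldCov Y P (t i - t j)) - N) := by
  have := hY_gauss.isProbabilityMeasure
  set μ := P.map fun ω i => Y (t i) ω with hμ
  have : IsGaussian μ := isGaussian_map_family hY_gauss _
  have hmeas : AEMeasurable (fun ω i => Y (t i) ω) P :=
    aemeasurable_pi_lambda _ fun i => hY_gauss.aemeasurable _
  have key := measure_orthant_le (μ := μ)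
    (integral_map_family hY_gauss hY_centered _)
    (fun i => by rw [covariance_map_family hY_gauss hY_homog, sub_self, hB_zero])
    (fun i j => by rw [covariance_map_family hY_gauss hY_homog]; exact hB_nonneg _)
  simp only [hμ, covariance_map_family hY_gauss hY_homog, Fintype.card_fin] at key
  refine le_trans ?_ key
  have hS : MeasurableSet {x : Fin N → ℝ | ∀ i, x i ≤ 0} := by
    simpa using measurableSet_forall_finset_nonpos (Finset.univ : Finset (Fin N))
  rw [map_measureReal_apply_of_aemeasurable hmeas hS]
  exact ENNReal.toReal_mono (measure_ne_top _ _) (measure_mono fun ω hω i => hω _ (ht i))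

theorem volume_real_stdCube {T : ℝ} (hT : 0 ≤ T) : volume.real (stdCube d T) = T ^ d := by
  unfold stdCube Measure.real
  rw [Real.volume_Icc_pi]
  simp [ENNReal.toReal_ofReal hT]

theorem exists_pos_le_neg_log_persistenceProb_stdCube (hd : 1 ≤ d)
    (hY_gauss : IsGaussianProcess Y P)
    (hY_cont : ∀ᵐ ω ∂P, Continuous (fun t => Y t ω))
    (hY_centered : ∀ t, ∫ ω, Y t ω ∂P = 0) (hY_homog : IsHomogeneousField Y P)
    (hB_nonneg : ∀ t, 0 ≤ fieldCov Y P t) (hB_zero : fieldCov Y P 0 = 1)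
    (hB : Integrable (fieldCov Y P) volume) :
    ∃ c > 0, ∀ᶠ T : ℝ in atTop,
      c ≤ -Real.log (persistenceProb Y P (stdCube d T)).toReal / T ^ d := by
  have := hY_gauss.isProbabilityMeasure
  set r := gaussianPosExp with hr
  -- With log r = -4ε, the gain 4ε per point from `r` outweighs the cost 2ε per point from the
  -- interactions, leaving a net exponent 2ε per point.
  set ε : ℝ := -Real.log r / 4 with hε
  have hε0 : 0 < ε := by
    have := Real.log_neg gaussianPosExp_pos gaussianPosExp_lt_one
    rw [hε]; linarith
  set I := ∫ x, fieldCov Y P x with hI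
  have hI0 : 0 ≤ I := integral_nonneg hB_nonneg
  have hsymm (x) : fieldCov Y P (-x) = fieldCov Y P x := by
    have h1 := covariance_eq_fieldCov hY_gauss hY_homog 0 x
    rw [zero_sub] at h1
    rw [← h1, covariance_comm]
    rfl
  -- The term (T^d)⁻¹ is the loss from rounding `N` down. The constant `c` is half of the limit,
  -- which absorbs this loss for large `T`.
  have hlim : Tendsto (fun T : ℝ => 2 * ε * (ε / (I + 1) - (T ^ d)⁻¹)) atTop
      (𝓝 (2 * ε * (ε / (I + 1) - 0))) :=
    ((tendsto_inv_atTop_zero.comp (tendsto_pow_atTop (by omega))).const_sub _).const_mul _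
  have hc : ε ^ 2 / (I + 1) < 2 * ε * (ε / (I + 1) - 0) := by
    have : 0 < ε ^ 2 / (I + 1) := by positivity
    have e : 2 * ε * (ε / (I + 1) - 0) = 2 * (ε ^ 2 / (I + 1)) := by ring
    rw [e]; linarith
  refine ⟨ε ^ 2 / (I + 1), by positivity, ?_⟩
  filter_upwards [hlim.eventually (lt_mem_nhds hc), eventually_gt_atTop 0] with T hT hT0
  refine hT.le.trans ?_
  have hTd : 0 < T ^ d := pow_pos hT0 d
  -- The largest order of points allowed by N ∫B ≤ ε T^d; using I + 1 instead of I keeps the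
  -- denominator positive.
  set N := ⌊ε * T ^ d / (I + 1)⌋₊ with hN
  have hN1 : (N : ℝ) * (I + 1) ≤ ε * T ^ d := by
    rw [← le_div_iff₀ (by positivity)]
    exact Nat.floor_le (by positivity)
  have hN2 : ε * T ^ d / (I + 1) < N + 1 := Nat.lt_floor_add_one _
  have hvol : volume.real (stdCube d T) = T ^ d := volume_real_stdCube hT0.le
  have hQ0 : volume (stdCube d T) ≠ 0 := fun h => by
    rw [Measure.real, h] at hvol
    exact hTd.ne' (by simpa using hvol.symm)
  have hbdd : Bornology.IsBounded (stdCube d T) := Metric.isBounded_Icc _ _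
  have hNI : (N : ℝ) * ∫ x, fieldCov Y P x ≤ ε * volume.real (stdCube d T) := by
    rw [hvol]
    refine le_trans ?_ hN1
    gcongr
    linarith
  obtain ⟨t, htQ, ht⟩ := exists_points_sum_le hB hB_nonneg hsymm hQ0 hbdd.measure_lt_top.ne hNI N
    le_rfl
  have hp := persistenceProb_le_of_points hY_gauss hY_centered hY_homog hB_nonneg hB_zero
    (fun i : Fin N => t i) (fun i => htQ i i.2)
  rw [Finset.sum_range] at ht
  simp_rw [Finset.sum_range] at ht
  rw [hB_zero] at ht
  have hpos : 0 < (persistenceProb Y P (stdCube d T)).toReal :=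
    ENNReal.toReal_pos (persistenceProb_pos hY_gauss hY_cont hY_centered hY_homog hB_nonneg
      hB_zero hbdd).ne' (measure_ne_top _ _)
  have hlog := Real.log_le_log hpos hp
  rw [Real.log_mul (pow_pos gaussianPosExp_pos _).ne' (Real.exp_pos _).ne', Real.log_exp,
    Real.log_pow] at hlog
  have hr4 : Real.log r = -(4 * ε) := by rw [hε]; ring
  rw [← hr, hr4] at hlog
  rw [le_div_iff₀ hTd]
  have e : 2 * ε * (ε / (I + 1) - (T ^ d)⁻¹) * T ^ d = 2 * ε * (ε * T ^ d / (I + 1) - 1) := by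
    field_simp
  rw [e]
  have : 2 * ε * (ε * T ^ d / (I + 1) - 1) ≤ 2 * ε * N := by
    gcongr
    linarith
  linarith

end Positivity

theorem theorem1 {Ω : Type*} [MeasurableSpace Ω] (P : Measure Ω) [IsProbabilityMeasure P]
    (d : ℕ) (hd : 1 ≤ d) (Y : (Fin d → ℝ) → Ω → ℝ)
    (hY_gauss : IsGaussianProcess Y P)
    (hY_cont : ∀ᵐ ω ∂P, Continuous (fun t => Y t ω))
    (hY_centered : ∀ t, ∫ ω, Y t ω ∂P = 0)
    (hY_homog : IsHomogeneousField Y P)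
    (hB_nonneg : ∀ t, 0 ≤ fieldCov Y P t)
    (hB_zero : fieldCov Y P 0 = 1)
    (G : Set (Fin d → ℝ)) (hG_region : IsRegion G) (hG_bdd : Bornology.IsBounded G)
    (hG_reg : HasRegularBoundary G) :
    ∃ θ : ℝ, HasPersistenceExponent Y P G (θ : EReal) ∧
      (Integrable (fieldCov Y P) volume → 0 < θ) := by
  have hf := isInvariantSubadditive_neg_log_persistenceProb hY_gauss hY_cont hY_centered hY_homog
    hB_nonneg hB_zero
  obtain ⟨θ, hθ⟩ := hf.exists_tendsto_stdCube
  -- The exponent is the cube constant times |G|, and |G| > 0 because `G` has interior points;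
  -- positivity thus reduces to cubes.
  refine ⟨θ * (volume G).toReal, hasPersistenceExponent_of_tendsto (fun T => ?_)
    (hf.tendsto_smul_div hθ hG_bdd hG_reg), fun hB => mul_pos ?_ ?_⟩
  · exact (persistenceProb_pos hY_gauss hY_cont hY_centered hY_homog hB_nonneg hB_zero
      (hG_bdd.smul₀ T)).ne'
  · obtain ⟨c, hc, hev⟩ := exists_pos_le_neg_log_persistenceProb_stdCube hd hY_gauss hY_cont
      hY_centered hY_homog hB_nonneg hB_zero hB
    exact hc.trans_le (ge_of_tendsto hθ hev)
  · exact ENNReal.toReal_pos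
      (Measure.measure_pos_of_nonempty_interior _ hG_region.nonempty_interior).ne'
      hG_bdd.measure_lt_top.ne
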